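/- Identify $\mathbb R^2$ with $\mathbb C$. Let $K\subset\mathbb C$ be a solid body: a compact set that is the closure of its connected, nonempty interior, with connected complement $\Omega=\mathbb C\setminus K$, such that, for some finite set $E$ (the corners), near every point of $\partial K\setminus E$ the set $\Omega$ is, in suitable Cartesian coordinates, the region above the graph of a $C^1$ function. A flow around $K$ is a differentiable vector field $v=(v^x,v^y)$ on $\Omega$ that * is incompressible and irrotational, $\nabla\cdot v=0$ and $\nabla\times v=0$ in $\Omega$; * satisfies the slip condition: for every $p\in\partial K\setminus E$ with normal $n(p)$, $n(p)\cdot v(z)\to0$ as $z\to p$, $z\in\Omega$; * is bounded near infinity and near every point of $\partial K\setminus E$, and square integrable on bounded subsets of $\Omega$ (these conditions hold in particular if $v$ is bounded on $\Omega$). Write $w=v^x-iv^y$ for the complex velocity. Then: 1. For every flow the velocity at infinity $w_\infty=\lim_{|z|\to\infty}w(z)$ exists, and the circulation $\Gamma=\oint_{|z|=R}v\cdot dx$ (counterclockwise) has the same value for all $R$ such that $K\subset\{|z|<R\}$. 2. Two flows around $K$ with the same $w_\infty$ and the same $\Gamma$ coincide on $\Omega$. 3. Suppose that $K$ has a protruding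 corner at $p\in\partial K$: there are $\Theta\in(\pi,2\pi)$ and $\alpha\in\mathbb R$ such that for every $\varepsilon>0$ there is $r>0$ such that for all $0<\rho<r$ the point $p+\rho e^{i(\alpha+\theta)}$ lies in $\Omega$ if $\varepsilon<\theta<\Theta-\varepsilon$, and in $K$ if $\Theta+\varepsilon<\theta<2\pi-\varepsilon$. Then two flows around $K$ with the same $w_\infty$ whose velocities are both bounded near $p$ coincide on $\Omega$; in particular they have the same $\Gamma$. -/

import Mathlib

open Set Filter Topology MeasureTheory

noncomputable section

/-- `Ω` is a one-sided `C¹` domain near `p`: in the orthonormal frame `(u, I * u)` centred at `p`,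
it is, inside a box, the set of points strictly above the graph of the `C¹` function `g`. -/
structure IsBoundaryChart (Ω : Set ℂ) (p u : ℂ) (g : ℝ → ℝ) (r : ℝ) : Prop where
  norm_eq_one : ‖u‖ = 1
  contDiff : ContDiff ℝ 1 g
  map_zero : g 0 = 0
  pos : 0 < r
  mem_iff : ∀ s t : ℝ, |s| < r → |t| < r →
    (p + u * ((s : ℂ) + (t : ℂ) * Complex.I) ∈ Ω ↔ g s < t)

/-- The normal at `p`, pointing into `Ω`, of the boundary described by a chart: the tangent
`u * (1 + g'(0) * I)` turned by a right angle (not normalised, never zero). -/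
def chartNormal (u : ℂ) (g : ℝ → ℝ) : ℂ :=
  Complex.I * (u * (1 + ((deriv g 0 : ℝ) : ℂ) * Complex.I))

/-- A solid body in the plane: the compact closure of a connected open set, with connected
complement, whose boundary is `C¹` except at finitely many points `E` (the corners). -/
structure IsBody (K E : Set ℂ) : Prop where
  isCompact : IsCompact K
  closure_interior : closure (interior K) = K
  isConnected_interior : IsConnected (interior K)
  isConnected_compl : IsConnected Kᶜ
  finite_corners : E.Finite
  exists_chart : ∀ p ∈ frontier K \ E, ∃ (u : ℂ) (g : ℝ → ℝ) (r : ℝ), IsBoundaryChart Kᶜ p u g r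

/-- At the boundary point `p` the body `K` has a corner whose exterior (fluid-side) angle is `Θ`:
up to arbitrarily small angular errors, near `p` the fluid fills the sector of directions
`α + θ`, `0 < θ < Θ`, and the body fills the sector `Θ < θ < 2π`. The two sides may be
straight or curved. -/
def HasExteriorAngle (K : Set ℂ) (p : ℂ) (Θ : ℝ) : Prop :=
  p ∈ frontier K ∧ ∃ α : ℝ, ∀ ε > 0, ∃ r > 0, ∀ ρ θ : ℝ, 0 < ρ → ρ < r →
    (ε < θ → θ < Θ - ε → p + ρ * Complex.exp ((α + θ : ℝ) * Complex.I) ∈ Kᶜ) ∧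
    (Θ + ε < θ → θ < 2 * Real.pi - ε → p + ρ * Complex.exp ((α + θ : ℝ) * Complex.I) ∈ K)

/-- A protruding corner: the exterior angle is larger than `π` (and less than `2π`). -/
def IsProtrudingCorner (K : Set ℂ) (p : ℂ) : Prop :=
  ∃ Θ : ℝ, Real.pi < Θ ∧ Θ < 2 * Real.pi ∧ HasExteriorAngle K p Θ

/-- Divergence `∂ₓ vˣ + ∂ᵧ vʸ` of the plane vector field `v = vˣ + i vʸ`. -/
def planeDiv (v : ℂ → ℂ) (z : ℂ) : ℝ :=
  (fderiv ℝ v z 1).re + (fderiv ℝ v z Complex.I).im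

/-- Scalar curl `∂ₓ vʸ - ∂ᵧ vˣ` of the plane vector field `v = vˣ + i vʸ`. -/
def planeCurl (v : ℂ → ℂ) (z : ℂ) : ℝ :=
  (fderiv ℝ v z 1).im - (fderiv ℝ v z Complex.I).re

/-- The velocity is bounded in the part of the fluid near `p`. -/
def VelocityBoundedNear (K : Set ℂ) (v : ℂ → ℂ) (p : ℂ) : Prop :=
  ∃ r > 0, ∃ C : ℝ, ∀ z ∈ Kᶜ, dist z p < r → ‖v z‖ ≤ C

/-- Incompressible irrotational flow around the body `K`, with velocity `v = vˣ + i vʸ` on `Kᶜ`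
and slip condition. The velocity is bounded at infinity and near every boundary point that is not
in `E`; near the points of `E` it is only required to be square integrable. Every velocity that
is bounded on `Kᶜ` meets these three size conditions. -/
structure IsFlow (K E : Set ℂ) (v : ℂ → ℂ) : Prop where
  differentiableOn : DifferentiableOn ℝ v Kᶜ
  incompressible : ∀ z ∈ Kᶜ, planeDiv v z = 0
  irrotational : ∀ z ∈ Kᶜ, planeCurl v z = 0
  slip : ∀ p ∈ frontier K \ E, ∀ (u : ℂ) (g : ℝ → ℝ) (r : ℝ), IsBoundaryChart Kᶜ p u g r →
    Tendsto (fun z => inner ℝ (chartNormal u g) (v z)) (𝓝[Kᶜ] p) (𝓝 0)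
  bounded_at_infinity : ∃ R C : ℝ, ∀ z ∈ Kᶜ, R < ‖z‖ → ‖v z‖ ≤ C
  bounded_near_regular : ∀ p ∈ frontier K \ E, VelocityBoundedNear K v p
  square_integrable : ∀ R : ℝ, IntegrableOn (fun z => ‖v z‖ ^ 2) (Kᶜ ∩ Metric.ball 0 R)

/-- The complex velocity `w = vˣ - i vʸ`. -/
def complexVelocity (v : ℂ → ℂ) (z : ℂ) : ℂ := (starRingEnd ℂ) (v z)

/-- The complex velocity tends to `wInf` at infinity. -/
def HasVelocityAtInfinity (v : ℂ → ℂ) (wInf : ℂ) : Prop :=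
  Tendsto (complexVelocity v) (Bornology.cobounded ℂ) (𝓝 wInf)

/-- The circulation `∫ v · dx` along every counterclockwise circle about the origin that encloses
the body is `Γ`. -/
def HasCirculation (K : Set ℂ) (v : ℂ → ℂ) (Γ : ℝ) : Prop :=
  ∀ R : ℝ, K ⊆ Metric.ball 0 R →
    ∫ θ in (0 : ℝ)..(2 * Real.pi),
      inner ℝ (v (circleMap 0 R θ)) (deriv (circleMap 0 R) θ) = Γ

end

/-!
Extended by zero across the body, a flow stays divergence free in the sense of distributions: near
a regular boundary point this is the slip condition, and the finitely many corners are negligible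
because the velocity is square integrable and a point of the plane has zero capacity. The extended
field therefore has a stream function `F` on the whole plane, which is constant on the connected
body, and we take the constant to be `0`. Suppose that the energy of `v` below every level `c < 0`
of `F` is finite. Testing irrotationality with a function of `F` that is constant above `c` shows
that either `v` vanishes or `F ≥ 0`.

The difference of two flows with the same velocity at infinity is a flow whose complex velocity is
`Γ / (2πiz) + O(z⁻²)` at infinity, where `Γ` is the difference of the circulations. If `Γ = 0`, then
the energy is finite and the argument applies to `F` and to `-F`, so that `F = 0` in the fluid. If
`Γ < 0`, then `F` tends to `+∞`, the sublevel sets are bounded, and `F > 0` in the fluid by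
Harnack's inequality. At a protruding corner the power map `ζ ↦ p + c * ζ ^ κ` with `κ > 1` sends a
disc touching `0` into the fluid, and Harnack's inequality on the disc bounds `F` from below, on the
image of the radius, by a multiple of the distance `x` to `0`. A bounded velocity would make
`F = O(x ^ κ)`.
-/

/-! ### Weakly divergence-free fields -/

theorem exists_contDiff_eq_one_near_isCompact {F : Type*} [NormedAddCommGroup F]
    [NormedSpace ℝ F] [FiniteDimensional ℝ F] {S U : Set F} (hS : IsCompact S)
    (hU : IsOpen U) (h : S ⊆ U) :
    ∃ β : F → ℝ, ContDiff ℝ 1 β ∧ tsupport β ⊆ U ∧ ∀ x ∈ S, β =ᶠ[𝓝 x] 1 := by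
  obtain ⟨T, hT, hST, hTU⟩ := exists_compact_between hS hU h
  obtain ⟨β, hβ_one, hβ_zero, -⟩ := exists_contMDiffMap_one_nhds_of_subset_interior (n := 1)
    (modelWithCornersSelf ℝ F) hS.isClosed hST
  refine ⟨β, β.contMDiff.contDiff, (closure_minimal ?_ hT.isClosed).trans hTU, fun x hx => ?_⟩
  · exact Function.support_subset_iff'.2 hβ_zero
  · exact eventually_nhdsSet_iff_forall.1 hβ_one x hx

theorem integrable_mul_of_continuousOn_tsupport {X : Type*} [TopologicalSpace X] [T2Space X]
    [MeasurableSpace X] [BorelSpace X] {μ : Measure X} [IsFiniteMeasureOnCompacts μ] {f g : X → ℝ}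
    (hf : ContinuousOn f (tsupport g)) (hg : Continuous g) (hc : HasCompactSupport g) :
    Integrable (fun z => f z * g z) μ :=
  ((hf.mul hg.continuousOn).integrableOn_compact hc.isCompact).integrable_of_forall_notMem_eq_zero
    fun z hz => by simp [image_eq_zero_of_notMem_tsupport hz]

section WeakDivergence

variable {F : Type*} [NormedAddCommGroup F] [NormedSpace ℝ F] [MeasurableSpace F] {μ : Measure F}
  {V : F → F} {φ : F → ℝ} {U U₁ U₂ : Set F}

/-- `V` has zero divergence on `U` in the sense of distributions, tested against `C¹` functions
with compact support in `U`. -/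
def IsWeaklyDivFreeOn (V : F → F) (U : Set F) (μ : Measure F) : Prop :=
  ∀ φ : F → ℝ, ContDiff ℝ 1 φ → HasCompactSupport φ → tsupport φ ⊆ U →
    ∫ z, fderiv ℝ φ z (V z) ∂μ = 0

theorem IsWeaklyDivFreeOn.mono (hV : IsWeaklyDivFreeOn V U₂ μ) (h : U₁ ⊆ U₂) :
    IsWeaklyDivFreeOn V U₁ μ :=
  fun φ hφ hc hs => hV φ hφ hc (hs.trans h)

theorem IsWeaklyDivFreeOn.congr {V' : F → F} (hV : IsWeaklyDivFreeOn V U μ) (h : EqOn V V' U) :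
    IsWeaklyDivFreeOn V' U μ := by
  intro φ hφ hc hs
  rw [← hV φ hφ hc hs]
  congr 1 with z
  by_cases hz : z ∈ tsupport φ
  · rw [h (hs hz)]
  · simp [fderiv_of_notMem_tsupport ℝ hz]

theorem isWeaklyDivFreeOn_of_eqOn_zero (h : EqOn V 0 U) : IsWeaklyDivFreeOn V U μ :=
  IsWeaklyDivFreeOn.congr (V := 0) (fun _ _ _ _ => by simp) h.symm

variable [BorelSpace F]

theorem integrable_mul_fderiv_of_continuousOn [IsFiniteMeasureOnCompacts μ] {f : F → ℝ}
    (hf : ContinuousOn f (tsupport φ)) (hφ : ContDiff ℝ 1 φ) (hc : HasCompactSupport φ) (e : F) :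
    Integrable (fun z => f z * fderiv ℝ φ z e) μ :=
  integrable_mul_of_continuousOn_tsupport (hf.mono (tsupport_fderiv_apply_subset ℝ e))
    ((hφ.continuous_fderiv one_ne_zero).clm_apply continuous_const) (hc.fderiv_apply ℝ e)

variable [FiniteDimensional ℝ F]

theorem integrable_fderiv_apply (hV : LocallyIntegrable V μ) (hφ : ContDiff ℝ 1 φ)
    (hc : HasCompactSupport φ) : Integrable (fun z => fderiv ℝ φ z (V z)) μ := by
  have hcont : Continuous (fderiv ℝ φ) := hφ.continuous_fderiv one_ne_zero
  obtain ⟨C, hC⟩ := (hc.fderiv ℝ).exists_bound_of_continuous hcont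
  have hint : IntegrableOn (fun z => fderiv ℝ φ z (V z)) (tsupport φ) μ :=
    (ContinuousLinearMap.id ℝ (F →L[ℝ] ℝ)).integrable_of_bilin_of_bdd_left C
      hcont.aestronglyMeasurable (.of_forall hC) (hV.integrableOn_isCompact hc.isCompact)
  exact hint.integrable_of_forall_notMem_eq_zero fun z hz => by
    simp [fderiv_of_notMem_tsupport ℝ hz]

theorem IsWeaklyDivFreeOn.union (hV : LocallyIntegrable V μ) (hU₁ : IsOpen U₁) (hU₂ : IsOpen U₂)
    (h₁ : IsWeaklyDivFreeOn V U₁ μ) (h₂ : IsWeaklyDivFreeOn V U₂ μ) :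
    IsWeaklyDivFreeOn V (U₁ ∪ U₂) μ := by
  intro φ hφ hc hs
  obtain ⟨β, hβ, hβU, hβ_one⟩ := exists_contDiff_eq_one_near_isCompact
    (hc.isCompact.diff hU₂) hU₁ fun z hz => (hs hz.1).resolve_right hz.2
  have hφ₁ : ContDiff ℝ 1 fun z => β z * φ z := hβ.mul hφ
  have hφ₂ : ContDiff ℝ 1 fun z => (1 - β z) * φ z := (contDiff_const.sub hβ).mul hφ
  have hs₂ : tsupport (fun z => (1 - β z) * φ z) ⊆ U₂ := by
    intro z hz
    by_contra hzU
    refine notMem_tsupport_iff_eventuallyEq.2 ?_ hz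
    filter_upwards [hβ_one z ⟨tsupport_mul_subset_right hz, hzU⟩] with y hy
    simp [hy]
  have hsplit : ∀ z, fderiv ℝ φ z (V z) = fderiv ℝ (fun z => β z * φ z) z (V z) +
      fderiv ℝ (fun z => (1 - β z) * φ z) z (V z) := by
    intro z
    rw [← add_apply, ← fderiv_fun_add (hφ₁.differentiable one_ne_zero z)
      (hφ₂.differentiable one_ne_zero z)]
    congr 2 with y
    ring
  simp_rw [hsplit]
  rw [integral_add (integrable_fderiv_apply hV hφ₁ hc.mul_left)
    (integrable_fderiv_apply hV hφ₂ hc.mul_left),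
    h₁ _ hφ₁ hc.mul_left (tsupport_mul_subset_left.trans hβU), h₂ _ hφ₂ hc.mul_left hs₂, add_zero]

theorem IsWeaklyDivFreeOn.of_locally (hV : LocallyIntegrable V μ)
    (h : ∀ x ∈ U, ∃ W, IsOpen W ∧ x ∈ W ∧ IsWeaklyDivFreeOn V W μ) :
    IsWeaklyDivFreeOn V U μ := by
  intro φ hφ hc hs
  obtain ⟨W, -, hφW, hW⟩ : ∃ W, IsOpen W ∧ tsupport φ ⊆ W ∧ IsWeaklyDivFreeOn V W μ := by
    refine hc.isCompact.induction_on (p := fun S => ∃ W, IsOpen W ∧ S ⊆ W ∧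
      IsWeaklyDivFreeOn V W μ) ?_ ?_ ?_ ?_
    · exact ⟨∅, isOpen_empty, Subset.rfl, isWeaklyDivFreeOn_of_eqOn_zero (eqOn_empty _ _)⟩
    · rintro S T hST ⟨W, hW, hTW, hVW⟩
      exact ⟨W, hW, hST.trans hTW, hVW⟩
    · rintro S T ⟨W₁, hW₁, hSW₁, hVW₁⟩ ⟨W₂, hW₂, hTW₂, hVW₂⟩
      exact ⟨W₁ ∪ W₂, hW₁.union hW₂, union_subset_union hSW₁ hTW₂,
        hVW₁.union hV hW₁ hW₂ hVW₂⟩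
    · intro x hx
      obtain ⟨W, hW, hxW, hVW⟩ := h x (hs hx)
      exact ⟨W, mem_nhdsWithin_of_mem_nhds (hW.mem_nhds hxW), W, hW, Subset.rfl, hVW⟩
  exact hW φ hφ hc hφW

theorem integral_mul_fderiv_eq_neg_of_tsupport_subset [μ.IsAddHaarMeasure] {f : F → ℝ}
    (hU : IsOpen U) (hf : ContDiffOn ℝ 1 f U) (hφ : ContDiff ℝ 1 φ) (hc : HasCompactSupport φ)
    (hs : tsupport φ ⊆ U) (e : F) :
    ∫ z, f z * fderiv ℝ φ z e ∂μ = -∫ z, fderiv ℝ f z e * φ z ∂μ :=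
  integral_mul_fderiv_eq_neg_fderiv_mul_of_integrable
    (integrable_mul_of_continuousOn_tsupport
      (((hf.continuousOn_fderiv_of_isOpen hU le_rfl).mono hs).clm_apply continuousOn_const)
      hφ.continuous hc)
    (integrable_mul_fderiv_of_continuousOn (hf.continuousOn.mono hs) hφ hc e)
    (integrable_mul_of_continuousOn_tsupport (hf.continuousOn.mono hs) hφ.continuous hc)
    (fun _ hz => (hf.contDiffAt (hU.mem_nhds (hs hz))).differentiableAt one_ne_zero)
    fun _ _ => hφ.differentiable one_ne_zero _

end WeakDivergence

theorem clm_apply_eq_re_mul_add_im_mul (L : ℂ →L[ℝ] ℝ) (z : ℂ) :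
    L z = z.re * L 1 + z.im * L Complex.I := by
  have hz : z = z.re • (1 : ℂ) + z.im • Complex.I := by simp
  conv_lhs => rw [hz]
  rw [map_add, map_smul, map_smul, smul_eq_mul, smul_eq_mul]

theorem fderiv_re_one_eq_fderiv_im_I {w : ℂ → ℂ} {z : ℂ} (hw : DifferentiableAt ℂ w z) :
    fderiv ℝ (fun y => (w y).re) z 1 = fderiv ℝ (fun y => (w y).im) z Complex.I := by
  have hd := hw.hasDerivAt.complexToReal_fderiv
  have hre := (Complex.reCLM.hasFDerivAt.comp z hd).fderiv
  have him := (Complex.imCLM.hasFDerivAt.comp z hd).fderiv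
  simp only [Function.comp_def, Complex.reCLM_apply, Complex.imCLM_apply] at hre him
  simp [hre, him]

theorem isWeaklyDivFreeOn_conj {w : ℂ → ℂ} {U : Set ℂ} (hU : IsOpen U)
    (hw : DifferentiableOn ℂ w U) :
    IsWeaklyDivFreeOn (fun z => starRingEnd ℂ (w z)) U volume := by
  intro φ hφ hc hs
  have hw_smooth : ContDiffOn ℝ 1 w U := (hw.contDiffOn hU).restrict_scalars ℝ
  have hre : ContDiffOn ℝ 1 (fun z => (w z).re) U :=
    Complex.reCLM.contDiff.comp_contDiffOn hw_smooth
  have him : ContDiffOn ℝ 1 (fun z => (w z).im) U :=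
    Complex.imCLM.contDiff.comp_contDiffOn hw_smooth
  calc ∫ z, fderiv ℝ φ z (starRingEnd ℂ (w z))
      = ∫ z, ((w z).re * fderiv ℝ φ z 1 - (w z).im * fderiv ℝ φ z Complex.I) := by
        congr 1 with z
        rw [clm_apply_eq_re_mul_add_im_mul]
        simp [sub_eq_add_neg]
    _ = (∫ z, (w z).re * fderiv ℝ φ z 1) - ∫ z, (w z).im * fderiv ℝ φ z Complex.I :=
        integral_sub (integrable_mul_fderiv_of_continuousOn (hre.continuousOn.mono hs) hφ hc _)
          (integrable_mul_fderiv_of_continuousOn (him.continuousOn.mono hs) hφ hc _)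
    _ = (∫ z, fderiv ℝ (fun y => (w y).im) z Complex.I * φ z) -
          ∫ z, fderiv ℝ (fun y => (w y).re) z 1 * φ z := by
        rw [integral_mul_fderiv_eq_neg_of_tsupport_subset hU hre hφ hc hs,
          integral_mul_fderiv_eq_neg_of_tsupport_subset hU him hφ hc hs]
        ring
    _ = 0 := by
        rw [sub_eq_zero]
        congr 1 with z
        by_cases hz : z ∈ tsupport φ
        · rw [fderiv_re_one_eq_fderiv_im_I
            ((hw z (hs hz)).differentiableAt (hU.mem_nhds (hs hz)))]
        · simp [image_eq_zero_of_notMem_tsupport hz]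

/-! ### Logarithmic cutoffs -/

/-- A sequence of `C¹` cutoff functions vanishing near infinity and near the points of `E`, which
tends to `1` and whose Dirichlet integrals tend to zero. -/
structure IsCutoffSeq (E : Set ℂ) (χ : ℕ → ℂ → ℝ) : Prop where
  contDiff : ∀ n, ContDiff ℝ 1 (χ n)
  hasCompactSupport : ∀ n, HasCompactSupport (χ n)
  notMem_tsupport : ∀ n, ∀ e ∈ E, e ∉ tsupport (χ n)
  nonneg : ∀ n z, 0 ≤ χ n z
  le_one : ∀ n z, χ n z ≤ 1
  ae_tendsto : ∀ᵐ z, Tendsto (fun n => χ n z) atTop (𝓝 1)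
  tendsto_energy : Tendsto (fun n => ∫ z, ‖fderiv ℝ (χ n) z‖ ^ 2) atTop (𝓝 0)

theorem integrable_norm_fderiv_sq {χ : ℂ → ℝ} (h : ContDiff ℝ 1 χ) (hc : HasCompactSupport χ) :
    Integrable fun z => ‖fderiv ℝ χ z‖ ^ 2 :=
  ((h.continuous_fderiv one_ne_zero).memLp_of_hasCompactSupport (p := 2)
    (hc.fderiv ℝ)).integrable_norm_pow two_ne_zero

/-- The smooth profile used to build logarithmic cutoffs. -/
noncomputable def cutoffProfile : ContDiffBump (0 : ℝ) := ⟨1, 2, one_pos, one_lt_two⟩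

/-- The logarithmic cutoff, equal to `1` for `|log ‖z‖| ≤ n + 1` and to `0` for
`|log ‖z‖| ≥ 2 (n + 1)`; the value at `0` is set by hand, as `Real.log 0 = 0`. -/
noncomputable def logCutoff (n : ℕ) (z : ℂ) : ℝ :=
  if z = 0 then 0 else cutoffProfile (Real.log ‖z‖ / (n + 1))

theorem tsupport_logCutoff_subset (n : ℕ) : tsupport (logCutoff n) ⊆
    {z | ‖z‖ ∈ Icc (Real.exp (-(2 * (n + 1)))) (Real.exp (2 * (n + 1)))} := by
  refine closure_minimal (fun z hz => ?_) (isClosed_Icc.preimage continuous_norm)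
  have hz₀ : z ≠ 0 := by
    rintro rfl
    simp [logCutoff] at hz
  have hlog : |Real.log ‖z‖| < 2 * (n + 1) := by
    rw [Function.mem_support, logCutoff, if_neg hz₀, ← Function.mem_support,
      cutoffProfile.support_eq, Metric.mem_ball, dist_zero_right, norm_div, Real.norm_eq_abs,
      Real.norm_of_nonneg (by positivity), div_lt_iff₀ (by positivity)] at hz
    exact hz
  rw [abs_lt, Real.lt_log_iff_exp_lt (norm_pos_iff.2 hz₀),
    Real.log_lt_iff_lt_exp (norm_pos_iff.2 hz₀)] at hlog
  exact ⟨hlog.1.le, hlog.2.le⟩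

theorem zero_notMem_tsupport_logCutoff (n : ℕ) : (0 : ℂ) ∉ tsupport (logCutoff n) := fun h =>
  (Real.exp_pos _).not_ge (by simpa using (tsupport_logCutoff_subset n h).1)

theorem logCutoff_eventuallyEq (n : ℕ) {z : ℂ} (hz : z ≠ 0) :
    logCutoff n =ᶠ[𝓝 z] fun y => cutoffProfile (Real.log ‖y‖ / (n + 1)) := by
  filter_upwards [isOpen_ne.mem_nhds hz] with y hy using if_neg hy

theorem contDiff_logCutoff (n : ℕ) : ContDiff ℝ 1 (logCutoff n) := by
  refine contDiff_iff_contDiffAt.2 fun z => ?_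
  by_cases hz : z = 0
  · subst hz
    exact contDiffAt_const.congr_of_eventuallyEq
      (notMem_tsupport_iff_eventuallyEq.1 (zero_notMem_tsupport_logCutoff n))
  · refine ContDiffAt.congr_of_eventuallyEq ?_ (logCutoff_eventuallyEq n hz)
    exact cutoffProfile.contDiff.contDiffAt.comp z
      (((contDiffAt_norm ℝ hz).log (norm_ne_zero_iff.2 hz)).div_const _)

theorem hasCompactSupport_logCutoff (n : ℕ) : HasCompactSupport (logCutoff n) :=
  (isCompact_closedBall (0 : ℂ) (Real.exp (2 * (n + 1)))).of_isClosed_subset (isClosed_tsupport _)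
    fun z hz => by simpa using (tsupport_logCutoff_subset n hz).2

theorem norm_fderiv_log_norm_div_le {z : ℂ} (hz : z ≠ 0) {c : ℝ} (hc : 0 < c) :
    ‖fderiv ℝ (fun y : ℂ => Real.log ‖y‖ / c) z‖ ≤ (c * ‖z‖)⁻¹ := by
  have hnorm : DifferentiableAt ℝ (fun y : ℂ => ‖y‖) z := differentiableAt_id.norm ℝ hz
  have hnorm_le : ‖fderiv ℝ (fun y : ℂ => ‖y‖) z‖ ≤ 1 := by
    simpa using norm_fderiv_le_of_lipschitz ℝ (x₀ := z) (lipschitzWith_one_norm (E := ℂ))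
  simp_rw [div_eq_mul_inv]
  rw [((hnorm.hasFDerivAt.log (norm_ne_zero_iff.2 hz)).mul_const c⁻¹).fderiv, norm_smul, norm_smul,
    norm_inv, norm_inv, norm_norm, Real.norm_of_nonneg hc.le, mul_inv]
  gcongr
  exact mul_le_of_le_one_right (by positivity) hnorm_le

theorem exists_norm_fderiv_logCutoff_le : ∃ C : ℝ, ∀ (n : ℕ) (z : ℂ),
    ‖fderiv ℝ (logCutoff n) z‖ ≤ C / ((n + 1) * ‖z‖) := by
  obtain ⟨C, hC⟩ := cutoffProfile.hasCompactSupport.deriv.exists_bound_of_continuous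
    (cutoffProfile.contDiff.continuous_deriv (n := 1) le_rfl)
  refine ⟨C, fun n z => ?_⟩
  by_cases hz : z = 0
  · simp [hz, fderiv_of_notMem_tsupport ℝ (zero_notMem_tsupport_logCutoff n)]
  · have hlog : DifferentiableAt ℝ (fun y : ℂ => Real.log ‖y‖ / ((n : ℝ) + 1)) z := by
      simp_rw [div_eq_mul_inv]
      exact ((differentiableAt_id.norm ℝ hz).log (norm_ne_zero_iff.2 hz)).mul_const _
    have hprofile : DifferentiableAt ℝ cutoffProfile (Real.log ‖z‖ / (n + 1)) :=
      cutoffProfile.contDiff.differentiable (n := 1) one_ne_zero _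
    have hchain := (hprofile.hasDerivAt.comp_hasFDerivAt z hlog.hasFDerivAt).fderiv
    rw [Function.comp_def] at hchain
    rw [(logCutoff_eventuallyEq n hz).fderiv_eq, hchain, norm_smul, div_eq_mul_inv]
    exact mul_le_mul (hC _) (norm_fderiv_log_norm_div_le hz (by positivity)) (norm_nonneg _)
      ((norm_nonneg _).trans (hC 0))

theorem integral_annulus_norm_inv_sq {a b : ℝ} (ha : 0 < a) (hab : a ≤ b) :
    ∫ z : ℂ, (Icc a b).indicator (fun r => (r ^ 2)⁻¹) ‖z‖ = 2 * Real.pi * Real.log (b / a) := by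
  have radial : ∀ y : ℝ, y ^ (Module.finrank ℝ ℂ - 1) • (Icc a b).indicator (fun r => (r ^ 2)⁻¹) y =
      (Icc a b).indicator (fun r => r⁻¹) y := by
    intro y
    by_cases hy : y ∈ Icc a b
    · have : y ≠ 0 := (ha.trans_le hy.1).ne'
      simp only [indicator_of_mem hy, Complex.finrank_real_complex, smul_eq_mul]
      norm_num
      field_simp
    · simp [indicator_of_notMem hy]
  rw [integral_fun_norm_addHaar]
  simp_rw [radial]
  rw [setIntegral_indicator measurableSet_Icc,
    inter_eq_right.2 (show Icc a b ⊆ Ioi 0 from fun y hy => ha.trans_le hy.1),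
    integral_Icc_eq_integral_Ioc, ← intervalIntegral.integral_of_le hab,
    integral_inv_of_pos ha (ha.trans_le hab), Complex.finrank_real_complex]
  simp only [Measure.real, Complex.volume_ball, nsmul_eq_mul, smul_eq_mul]
  simp
  ring

theorem integrable_annulus_norm_inv_sq {a b : ℝ} (ha : 0 < a) (hab : a < b) :
    Integrable fun z : ℂ => (Icc a b).indicator (fun r => (r ^ 2)⁻¹) ‖z‖ := by
  refine .of_integral_ne_zero ?_
  rw [integral_annulus_norm_inv_sq ha hab.le]
  have : 0 < Real.log (b / a) := Real.log_pos ((one_lt_div ha).2 hab)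
  positivity

theorem integral_norm_fderiv_logCutoff_sq_le {C : ℝ} {n : ℕ}
    (hC : ∀ z, ‖fderiv ℝ (logCutoff n) z‖ ≤ C / ((n + 1) * ‖z‖)) :
    ∫ z, ‖fderiv ℝ (logCutoff n) z‖ ^ 2 ≤ 8 * Real.pi * C ^ 2 * (1 / ((n : ℝ) + 1)) := by
  set a := Real.exp (-(2 * ((n : ℝ) + 1)))
  set b := Real.exp (2 * ((n : ℝ) + 1))
  have ha₀ : 0 < a := Real.exp_pos _
  have hab : a < b := Real.exp_lt_exp.2 (by linarith [n.cast_nonneg (α := ℝ)])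
  have pointwise : ∀ z, ‖fderiv ℝ (logCutoff n) z‖ ^ 2 ≤
      (C ^ 2 / ((n : ℝ) + 1) ^ 2) * (Icc a b).indicator (fun r => (r ^ 2)⁻¹) ‖z‖ := by
    intro z
    by_cases hz : ‖z‖ ∈ Icc a b
    · rw [indicator_of_mem hz, ← div_eq_mul_inv, div_div, ← mul_pow, ← div_pow]
      exact pow_le_pow_left₀ (norm_nonneg _) (hC z) 2
    · rw [indicator_of_notMem hz,
        fderiv_of_notMem_tsupport ℝ fun h => hz (tsupport_logCutoff_subset n h)]
      simp
  calc ∫ z, ‖fderiv ℝ (logCutoff n) z‖ ^ 2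
      ≤ ∫ z : ℂ, (C ^ 2 / ((n : ℝ) + 1) ^ 2) *
          (Icc a b).indicator (fun r => (r ^ 2)⁻¹) ‖z‖ :=
        integral_mono (integrable_norm_fderiv_sq (contDiff_logCutoff n)
          (hasCompactSupport_logCutoff n))
          ((integrable_annulus_norm_inv_sq ha₀ hab).const_mul _) pointwise
    _ = 8 * Real.pi * C ^ 2 * (1 / ((n : ℝ) + 1)) := by
        rw [integral_const_mul, integral_annulus_norm_inv_sq ha₀ hab.le,
          Real.log_div (Real.exp_pos _).ne' (Real.exp_pos _).ne', Real.log_exp, Real.log_exp]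
        field_simp
        ring

theorem tendsto_energy_logCutoff :
    Tendsto (fun n => ∫ z, ‖fderiv ℝ (logCutoff n) z‖ ^ 2) atTop (𝓝 0) := by
  obtain ⟨C, hC⟩ := exists_norm_fderiv_logCutoff_le
  refine squeeze_zero (fun n => by positivity)
    (fun n => integral_norm_fderiv_logCutoff_sq_le (hC n)) ?_
  simpa using (tendsto_one_div_add_atTop_nhds_zero_nat (𝕜 := ℝ)).const_mul (8 * Real.pi * C ^ 2)

theorem tendsto_logCutoff {z : ℂ} (hz : z ≠ 0) :
    Tendsto (fun n => logCutoff n z) atTop (𝓝 1) := by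
  have hlog : Tendsto (fun n : ℕ => Real.log ‖z‖ / ((n : ℝ) + 1)) atTop (𝓝 0) := by
    simpa [div_eq_mul_inv] using
      (tendsto_one_div_add_atTop_nhds_zero_nat (𝕜 := ℝ)).const_mul (Real.log ‖z‖)
  have hprofile := (cutoffProfile.continuous.tendsto 0).comp hlog
  rw [cutoffProfile.one_of_mem_closedBall (by simp [cutoffProfile])] at hprofile
  exact hprofile.congr fun n => (if_neg hz).symm

theorem isCutoffSeq_logCutoff : IsCutoffSeq {0} logCutoff where
  contDiff := contDiff_logCutoff
  hasCompactSupport := hasCompactSupport_logCutoff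
  notMem_tsupport := by
    rintro n e rfl
    exact zero_notMem_tsupport_logCutoff n
  nonneg n z := by
    rw [logCutoff]
    split_ifs
    exacts [le_rfl, cutoffProfile.nonneg]
  le_one n z := by
    rw [logCutoff]
    split_ifs
    exacts [zero_le_one, cutoffProfile.le_one]
  ae_tendsto := (ae_iff.2 (by simp) : ∀ᵐ z : ℂ, z ≠ 0).mono fun _ => tendsto_logCutoff
  tendsto_energy := tendsto_energy_logCutoff

theorem IsCutoffSeq.translate {χ : ℕ → ℂ → ℝ} (h : IsCutoffSeq {0} χ) (e : ℂ) :
    IsCutoffSeq {e} fun n z => χ n (z - e) where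
  contDiff n := (h.contDiff n).comp (contDiff_id.sub contDiff_const)
  hasCompactSupport n := (h.hasCompactSupport n).comp_homeomorph (Homeomorph.subRight e)
  notMem_tsupport n x hx := by
    change x ∉ tsupport (χ n ∘ Homeomorph.subRight e)
    rw [tsupport_comp_eq_preimage]
    simpa [mem_singleton_iff.1 hx] using h.notMem_tsupport n 0 rfl
  nonneg n z := h.nonneg n _
  le_one n z := h.le_one n _
  ae_tendsto := (measurePreserving_sub_right volume e).quasiMeasurePreserving.ae h.ae_tendsto
  tendsto_energy := by
    refine h.tendsto_energy.congr fun n => ?_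
    simp_rw [fderiv_comp_sub]
    exact (integral_sub_right_eq_self (fun z => ‖fderiv ℝ (χ n) z‖ ^ 2) e).symm

theorem norm_fderiv_mul_sq_le {F : Type*} [NormedAddCommGroup F] [NormedSpace ℝ F] {a b : F → ℝ}
    {z : F} (ha : DifferentiableAt ℝ a z) (hb : DifferentiableAt ℝ b z) (ha₁ : |a z| ≤ 1)
    (hb₁ : |b z| ≤ 1) :
    ‖fderiv ℝ (fun y => a y * b y) z‖ ^ 2 ≤ 2 * ‖fderiv ℝ a z‖ ^ 2 + 2 * ‖fderiv ℝ b z‖ ^ 2 := by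
  have hle : ‖fderiv ℝ (fun y => a y * b y) z‖ ≤ ‖fderiv ℝ b z‖ + ‖fderiv ℝ a z‖ := by
    rw [fderiv_fun_mul ha hb]
    refine norm_add_le_of_le ?_ ?_ <;> rw [norm_smul]
    exacts [mul_le_of_le_one_left (norm_nonneg _) ha₁, mul_le_of_le_one_left (norm_nonneg _) hb₁]
  calc ‖fderiv ℝ (fun y => a y * b y) z‖ ^ 2 ≤ (‖fderiv ℝ b z‖ + ‖fderiv ℝ a z‖) ^ 2 := by gcongr
    _ ≤ 2 * (‖fderiv ℝ b z‖ ^ 2 + ‖fderiv ℝ a z‖ ^ 2) := add_sq_le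
    _ = 2 * ‖fderiv ℝ a z‖ ^ 2 + 2 * ‖fderiv ℝ b z‖ ^ 2 := by ring

theorem IsCutoffSeq.mul {E₁ E₂ : Set ℂ} {χ₁ χ₂ : ℕ → ℂ → ℝ} (h₁ : IsCutoffSeq E₁ χ₁)
    (h₂ : IsCutoffSeq E₂ χ₂) : IsCutoffSeq (E₁ ∪ E₂) fun n z => χ₁ n z * χ₂ n z where
  contDiff n := (h₁.contDiff n).mul (h₂.contDiff n)
  hasCompactSupport n := (h₁.hasCompactSupport n).mul_right
  notMem_tsupport n e he h := he.elim
    (fun he => h₁.notMem_tsupport n e he (tsupport_mul_subset_left h))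
    (fun he => h₂.notMem_tsupport n e he (tsupport_mul_subset_right h))
  nonneg n z := mul_nonneg (h₁.nonneg n z) (h₂.nonneg n z)
  le_one n z := mul_le_one₀ (h₁.le_one n z) (h₂.nonneg n z) (h₂.le_one n z)
  ae_tendsto := by
    filter_upwards [h₁.ae_tendsto, h₂.ae_tendsto] with z hz₁ hz₂
    simpa using hz₁.mul hz₂
  tendsto_energy := by
    have int₁ n := (integrable_norm_fderiv_sq (h₁.contDiff n) (h₁.hasCompactSupport n)).const_mul 2
    have int₂ n := (integrable_norm_fderiv_sq (h₂.contDiff n) (h₂.hasCompactSupport n)).const_mul 2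
    have hle : ∀ n, ∫ z, ‖fderiv ℝ (fun z => χ₁ n z * χ₂ n z) z‖ ^ 2 ≤
        2 * (∫ z, ‖fderiv ℝ (χ₁ n) z‖ ^ 2) + 2 * ∫ z, ‖fderiv ℝ (χ₂ n) z‖ ^ 2 := by
      intro n
      rw [← integral_const_mul, ← integral_const_mul, ← integral_add (int₁ n) (int₂ n)]
      refine integral_mono (integrable_norm_fderiv_sq ((h₁.contDiff n).mul (h₂.contDiff n))
        (h₁.hasCompactSupport n).mul_right) ((int₁ n).add (int₂ n)) fun z => ?_
      refine norm_fderiv_mul_sq_le ((h₁.contDiff n).differentiable one_ne_zero z)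
        ((h₂.contDiff n).differentiable one_ne_zero z) ?_ ?_
      · rw [abs_of_nonneg (h₁.nonneg n z)]; exact h₁.le_one n z
      · rw [abs_of_nonneg (h₂.nonneg n z)]; exact h₂.le_one n z
    refine squeeze_zero (fun n => by positivity) hle ?_
    simpa using (h₁.tendsto_energy.const_mul 2).add (h₂.tendsto_energy.const_mul 2)

theorem exists_isCutoffSeq {E : Set ℂ} (hE : E.Finite) : ∃ χ, IsCutoffSeq E χ := by
  suffices h : ∃ χ, IsCutoffSeq (E ∪ {0}) χ by
    obtain ⟨χ, hχ⟩ := h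
    exact ⟨χ, { hχ with notMem_tsupport := fun n e he => hχ.notMem_tsupport n e (Or.inl he) }⟩
  induction E, hE using Set.Finite.induction_on with
  | empty => exact ⟨logCutoff, by simpa using isCutoffSeq_logCutoff⟩
  | @insert e s _ _ ih =>
    obtain ⟨χ, hχ⟩ := ih
    rw [insert_eq, union_assoc]
    exact ⟨_, (isCutoffSeq_logCutoff.translate e).mul hχ⟩

theorem IsCutoffSeq.tendsto_integral_fderiv_apply {E : Set ℂ} {χ : ℕ → ℂ → ℝ}
    (h : IsCutoffSeq E χ) {X : ℂ → ℂ} (hX : MemLp X 2) :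
    Tendsto (fun n => ∫ z, fderiv ℝ (χ n) z (X z)) atTop (𝓝 0) := by
  have cauchy_schwarz : ∀ n, ‖∫ z, fderiv ℝ (χ n) z (X z)‖ ≤
      (∫ z, ‖fderiv ℝ (χ n) z‖ ^ 2) ^ (1 / 2 : ℝ) * (∫ z, ‖X z‖ ^ 2) ^ (1 / 2 : ℝ) := by
    intro n
    have hχ : MemLp (fun z => ‖fderiv ℝ (χ n) z‖) 2 :=
      (((h.contDiff n).continuous_fderiv one_ne_zero).memLp_of_hasCompactSupport
        ((h.hasCompactSupport n).fderiv ℝ)).norm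
    have hölder := integral_mul_le_Lp_mul_Lq_of_nonneg (μ := volume) Real.HolderConjugate.two_two
      (.of_forall fun z => norm_nonneg (fderiv ℝ (χ n) z)) (.of_forall fun z => norm_nonneg (X z))
      (by simpa using hχ) (by simpa using hX.norm)
    simp only [Real.rpow_two] at hölder
    exact (norm_integral_le_of_norm_le (hχ.integrable_mul hX.norm)
      (.of_forall fun z => (fderiv ℝ (χ n) z).le_opNorm _)).trans hölder
  refine squeeze_zero_norm cauchy_schwarz ?_
  simpa using (h.tendsto_energy.rpow_const (p := 1 / 2) (Or.inr (by norm_num))).mul_const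
    ((∫ z, ‖X z‖ ^ 2) ^ (1 / 2 : ℝ))

theorem locallyIntegrable_of_memLp_two_ball {F : Type*} [NormedAddCommGroup F] [ProperSpace F]
    [MeasurableSpace F] {μ : Measure F} [IsFiniteMeasureOnCompacts μ] {G : Type*}
    [NormedAddCommGroup G] {V : F → G}
    (hV : ∀ R : ℝ, MemLp V 2 (μ.restrict (Metric.ball 0 R))) : LocallyIntegrable V μ := by
  intro x
  have : IsFiniteMeasure (μ.restrict (Metric.ball (0 : F) (‖x‖ + 1))) :=
    ⟨by simpa using measure_ball_lt_top⟩
  exact ⟨Metric.ball 0 (‖x‖ + 1), Metric.isOpen_ball.mem_nhds (by simp),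
    (hV _).integrable one_le_two⟩

theorem memLp_two_smul_of_hasCompactSupport {V : ℂ → ℂ}
    (hV : ∀ R : ℝ, MemLp V 2 (volume.restrict (Metric.ball 0 R))) {φ : ℂ → ℝ}
    (hφ : Continuous φ) (hc : HasCompactSupport φ) : MemLp (fun z => φ z • V z) 2 := by
  obtain ⟨R, hR⟩ := hc.isCompact.isBounded.subset_ball 0
  obtain ⟨C, hC⟩ := hc.exists_bound_of_continuous hφ
  have hindicator : (Metric.ball 0 R).indicator (fun z => φ z • V z) = fun z => φ z • V z :=
    indicator_eq_self.2 fun z hz => hR (subset_tsupport φ fun h => hz (by simp [h]))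
  rw [← hindicator, memLp_indicator_iff_restrict measurableSet_ball]
  exact (hV R).smul (memLp_top_of_bound hφ.aestronglyMeasurable C (.of_forall hC))

theorem IsWeaklyDivFreeOn.univ_of_compl_finite {V : ℂ → ℂ} {E : Set ℂ} (hE : E.Finite)
    (hV : ∀ R : ℝ, MemLp V 2 (volume.restrict (Metric.ball 0 R)))
    (h : IsWeaklyDivFreeOn V Eᶜ volume) : IsWeaklyDivFreeOn V univ volume := by
  intro φ hφ hc _
  obtain ⟨χ, hχ⟩ := exists_isCutoffSeq hE
  have hVloc : LocallyIntegrable V := locallyIntegrable_of_memLp_two_ball hV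
  have hint : Integrable fun z => fderiv ℝ φ z (V z) := integrable_fderiv_apply hVloc hφ hc
  have hbulk_int : ∀ n, Integrable fun z => χ n z * fderiv ℝ φ z (V z) := fun n =>
    hint.bdd_mul (c := 1) (hχ.contDiff n).continuous.aestronglyMeasurable
      (.of_forall fun z => by simpa [abs_of_nonneg (hχ.nonneg n z)] using hχ.le_one n z)
  have hcutoff_int : ∀ n, Integrable fun z => fderiv ℝ (χ n) z (φ z • V z) := fun n =>
    integrable_fderiv_apply
      (hVloc.integrable_smul_left_of_hasCompactSupport hφ.continuous hc).locallyIntegrable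
      (hχ.contDiff n) (hχ.hasCompactSupport n)
  have hsum : ∀ n, ∫ z, χ n z * fderiv ℝ φ z (V z) = -∫ z, fderiv ℝ (χ n) z (φ z • V z) := by
    intro n
    rw [eq_neg_iff_add_eq_zero, ← integral_add (hbulk_int n) (hcutoff_int n),
      ← h (fun z => χ n z * φ z) ((hχ.contDiff n).mul hφ) hc.mul_left
        fun z hz he => hχ.notMem_tsupport n z he (tsupport_mul_subset_left hz)]
    congr 1 with z
    rw [fderiv_fun_mul ((hχ.contDiff n).differentiable one_ne_zero z)
      (hφ.differentiable one_ne_zero z)]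
    simp only [add_apply, smul_apply, map_smul, smul_eq_mul]
  have hbulk : Tendsto (fun n => ∫ z, χ n z * fderiv ℝ φ z (V z)) atTop
      (𝓝 (∫ z, fderiv ℝ φ z (V z))) := by
    refine tendsto_integral_of_dominated_convergence _ (fun n => (hbulk_int n).1) hint.norm
      (fun n => .of_forall fun z => ?_) ?_
    · rw [norm_mul, Real.norm_of_nonneg (hχ.nonneg n z)]
      exact mul_le_of_le_one_left (norm_nonneg _) (hχ.le_one n z)
    · filter_upwards [hχ.ae_tendsto] with z hz
      simpa using hz.mul_const (fderiv ℝ φ z (V z))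
  refine tendsto_nhds_unique hbulk ?_
  simp_rw [hsum]
  simpa using (hχ.tendsto_integral_fderiv_apply
    (memLp_two_smul_of_hasCompactSupport hV hφ.continuous hc)).neg

/-! ### Boundary charts -/

section BoundaryChart

variable {K Ω : Set ℂ} {p u z : ℂ} {g : ℝ → ℝ} {r : ℝ}

/-- The height of `z` above the graph of `g`, in the frame `(u, I * u)` centred at `p`. -/
noncomputable def chartHeight (p u : ℂ) (g : ℝ → ℝ) (z : ℂ) : ℝ :=
  (starRingEnd ℂ u * (z - p)).im - g (starRingEnd ℂ u * (z - p)).re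

/-- The point with abscissa `x.1` and height `x.2` above the graph of `g`, in the frame
`(u, I * u)` centred at `p`. -/
noncomputable def graphPoint (p u : ℂ) (g : ℝ → ℝ) (x : ℝ × ℝ) : ℂ :=
  p + u * ((x.1 : ℂ) + ((g x.1 + x.2 : ℝ) : ℂ) * Complex.I)

theorem contDiff_chartHeight (p u : ℂ) (hg : ContDiff ℝ 1 g) :
    ContDiff ℝ 1 (chartHeight p u g) := by
  have hcoord : ContDiff ℝ 1 fun z : ℂ => starRingEnd ℂ u * (z - p) := by fun_prop
  exact (Complex.imCLM.contDiff.comp hcoord).sub (hg.comp (Complex.reCLM.contDiff.comp hcoord))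

theorem fderiv_chartHeight_apply (p u : ℂ) (hg : ContDiff ℝ 1 g) (z h : ℂ) :
    fderiv ℝ (chartHeight p u g) z h = inner ℝ (Complex.I *
      (u * (1 + ((deriv g (starRingEnd ℂ u * (z - p)).re : ℝ) : ℂ) * Complex.I))) h := by
  have hcoord : HasFDerivAt (fun z : ℂ => starRingEnd ℂ u * (z - p))
      (starRingEnd ℂ u • (1 : ℂ →L[ℝ] ℂ)) z := ((hasFDerivAt_id z).sub_const p).const_mul _
  have hre := Complex.reCLM.hasFDerivAt.comp z hcoord
  have hgraph := (hg.differentiable one_ne_zero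
    (starRingEnd ℂ u * (z - p)).re).hasDerivAt.comp_hasFDerivAt z hre
  have hheight : HasFDerivAt (chartHeight p u g) _ z :=
    (Complex.imCLM.hasFDerivAt.comp z hcoord).sub hgraph
  rw [hheight.fderiv]
  simp [Complex.inner]
  ring

theorem continuous_graphPoint (p u : ℂ) (hg : Continuous g) : Continuous (graphPoint p u g) := by
  unfold graphPoint
  fun_prop

theorem conj_mul_graphPoint_sub (hu : ‖u‖ = 1) (p : ℂ) (g : ℝ → ℝ) (x : ℝ × ℝ) :
    starRingEnd ℂ u * (graphPoint p u g x - p) =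
      (x.1 : ℂ) + ((g x.1 + x.2 : ℝ) : ℂ) * Complex.I := by
  rw [graphPoint, add_sub_cancel_left, ← mul_assoc, Complex.conj_mul', hu]
  simp

theorem chartHeight_graphPoint (hu : ‖u‖ = 1) (p : ℂ) (g : ℝ → ℝ) (x : ℝ × ℝ) :
    chartHeight p u g (graphPoint p u g x) = x.2 := by
  simp [chartHeight, conj_mul_graphPoint_sub hu]

theorem isClosedEmbedding_graphPoint (hu : ‖u‖ = 1) (p : ℂ) (hg : Continuous g) :
    IsClosedEmbedding (graphPoint p u g) := by
  refine Function.LeftInverse.isClosedEmbedding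
    (f := fun z => ((starRingEnd ℂ u * (z - p)).re, chartHeight p u g z)) (fun x => ?_) ?_
    (continuous_graphPoint p u hg)
  · refine Prod.ext ?_ (chartHeight_graphPoint hu p g x)
    simp [conj_mul_graphPoint_sub hu]
  · unfold chartHeight
    fun_prop

theorem measurePreserving_graphPoint (hu : ‖u‖ = 1) (p : ℂ) (hg : Continuous g) :
    MeasurePreserving (graphPoint p u g) := by
  have hshear : MeasurePreserving (fun x : ℝ × ℝ => (x.1, g x.1 + x.2)) :=
    (MeasurePreserving.id volume).skew_product (g := fun s t => g s + t) (by fun_prop)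
      (.of_forall fun s => map_add_left_eq_self volume (g s))
  have hrotation : MeasurePreserving (fun z : ℂ => u * z) :=
    (rotation (⟨u, by simpa [Submonoid.unitSphere] using hu⟩ : Circle)).measurePreserving
  have hcomp : graphPoint p u g = (fun z => p + z) ∘ (fun z => u * z) ∘
      Complex.measurableEquivRealProd.symm ∘ fun x : ℝ × ℝ => (x.1, g x.1 + x.2) := by
    funext x
    rw [graphPoint, ← Complex.mk_eq_add_mul_I]
    rfl
  rw [hcomp]
  exact (measurePreserving_add_left volume p).comp
    (hrotation.comp (Complex.volume_preserving_equiv_real_prod.symm.comp hshear))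

theorem tendsto_integral_prod_layer {k : ℝ × ℝ → ℝ} {η : ℝ → ℝ} (hk : Continuous k)
    (hkc : HasCompactSupport k) (hk_zero : ∀ s, k (s, 0) = 0) (hη : Continuous η)
    (hηc : HasCompactSupport η) :
    Tendsto (fun δ => ∫ x : ℝ × ℝ, k x * (η (x.2 / δ) / δ)) (𝓝[>] 0) (𝓝 0) := by
  have hS : IsCompact ((Prod.fst '' tsupport k) ×ˢ tsupport η) :=
    (hkc.isCompact.image continuous_fst).prod hηc
  have hzero : ∀ (δ : ℝ) (x : ℝ × ℝ), x ∉ (Prod.fst '' tsupport k) ×ˢ tsupport η →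
      k (x.1, δ * x.2) * η x.2 = 0 := by
    intro δ x hx
    by_cases hx₂ : x.2 ∈ tsupport η
    · have hx₁ : (x.1, δ * x.2) ∉ tsupport k := fun h => hx ⟨⟨_, h, rfl⟩, hx₂⟩
      rw [image_eq_zero_of_notMem_tsupport hx₁, zero_mul]
    · rw [image_eq_zero_of_notMem_tsupport hx₂, mul_zero]
  have hcont : Continuous fun δ : ℝ => ∫ x : ℝ × ℝ, k (x.1, δ * x.2) * η x.2 :=
    continuousOn_univ.1 <| continuousOn_integral_of_compact_support hS
      (Continuous.continuousOn (by fun_prop)) fun δ x _ => hzero δ x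
  have hscale : ∀ δ > 0, ∫ x : ℝ × ℝ, k x * (η (x.2 / δ) / δ) =
      ∫ x : ℝ × ℝ, k (x.1, δ * x.2) * η x.2 := by
    intro δ hδ
    rw [Measure.volume_eq_prod, integral_prod, integral_prod]
    · congr 1 with s
      have hsubst := Measure.integral_comp_mul_left (fun t => k (s, t) * (η (t / δ) / δ)) δ
      rw [abs_of_pos (inv_pos.2 hδ), smul_eq_mul, eq_inv_mul_iff_mul_eq₀ hδ.ne',
        ← integral_const_mul] at hsubst
      rw [← hsubst]
      congr 1 with σ
      field_simp
    · exact Continuous.integrable_of_hasCompactSupport (by fun_prop)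
        (HasCompactSupport.of_support_subset_isCompact hS
          fun x hx => not_imp_comm.1 (hzero δ x) hx)
    · exact Continuous.integrable_of_hasCompactSupport (by fun_prop) hkc.mul_right
  have hlim := (hcont.tendsto 0).mono_left (nhdsWithin_le_nhds (s := Ioi 0))
  simp only [zero_mul, hk_zero, integral_zero] at hlim
  exact hlim.congr' (eventually_mem_nhdsWithin.mono fun δ hδ => (hscale δ hδ).symm)

theorem tendsto_integral_chartHeight_layer (hu : ‖u‖ = 1) (hg : Continuous g) {k : ℂ → ℝ}
    {η : ℝ → ℝ} (hk : Continuous k) (hkc : HasCompactSupport k)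
    (hk_zero : ∀ z, chartHeight p u g z = 0 → k z = 0) (hη : Continuous η)
    (hηc : HasCompactSupport η) :
    Tendsto (fun δ => ∫ z, k z * (η (chartHeight p u g z / δ) / δ)) (𝓝[>] 0) (𝓝 0) := by
  have hemb := isClosedEmbedding_graphPoint hu p hg
  have hlim := tendsto_integral_prod_layer (hk.comp hemb.continuous)
    (hkc.comp_isClosedEmbedding hemb) (fun s => hk_zero _ (chartHeight_graphPoint hu p g _)) hη hηc
  refine hlim.congr fun δ => ?_
  rw [← (measurePreserving_graphPoint hu p hg).integral_comp hemb.measurableEmbedding]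
  simp only [chartHeight_graphPoint hu, Function.comp_apply]

theorem one_sub_cutoffProfile_eq_zero {x : ℝ} (hx : |x| ≤ 1) : 1 - cutoffProfile x = 0 :=
  sub_eq_zero.2 (cutoffProfile.one_of_mem_closedBall
    (by simpa [cutoffProfile] using hx)).symm

theorem norm_one_sub_cutoffProfile_le (x : ℝ) : ‖1 - cutoffProfile x‖ ≤ 1 := by
  have hle := cutoffProfile.le_one (x := x)
  have hnonneg := cutoffProfile.nonneg (x := x)
  rw [Real.norm_of_nonneg (by linarith)]
  linarith

theorem tsupport_one_sub_cutoffProfile_mul_subset {τ φ : ℂ → ℝ} (hτ : Continuous τ) {δ : ℝ}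
    (hδ : 0 < δ) : tsupport (fun z => (1 - cutoffProfile (τ z / δ)) * φ z) ⊆
      {z ∈ tsupport φ | τ z ≠ 0} := by
  refine fun z hz => ⟨tsupport_mul_subset_right hz, fun hτz => ?_⟩
  refine notMem_tsupport_iff_eventuallyEq.2 ?_ hz
  have hsmall : ∀ᶠ y in 𝓝 z, |τ y| < δ :=
    hτ.abs.continuousAt.eventually_lt continuousAt_const (by simpa [hτz] using hδ)
  filter_upwards [hsmall] with y hy
  rw [one_sub_cutoffProfile_eq_zero, zero_mul, Pi.zero_apply]
  rw [abs_div, abs_of_pos hδ]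
  exact (div_le_one hδ).2 hy.le

theorem integral_one_sub_cutoffProfile_mul_fderiv {V : ℂ → ℂ} {B : Set ℂ} {τ φ : ℂ → ℝ}
    (hV : LocallyIntegrable V) (hτ : ContDiff ℝ 1 τ)
    (hdiv : IsWeaklyDivFreeOn V {z ∈ B | τ z ≠ 0} volume) (hφ : ContDiff ℝ 1 φ)
    (hφc : HasCompactSupport φ) (hφB : tsupport φ ⊆ B) {δ : ℝ} (hδ : 0 < δ) :
    ∫ z, (1 - cutoffProfile (τ z / δ)) * fderiv ℝ φ z (V z) =
      ∫ z, φ z * fderiv ℝ τ z (V z) * (deriv cutoffProfile (τ z / δ) / δ) := by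
  have hψ : ContDiff ℝ 1 fun z => 1 - cutoffProfile (τ z / δ) :=
    contDiff_const.sub (cutoffProfile.contDiff.comp (hτ.div_const δ))
  have hψ_deriv : ∀ z, HasFDerivAt (fun z => 1 - cutoffProfile (τ z / δ))
      (-((deriv cutoffProfile (τ z / δ) / δ) • fderiv ℝ τ z)) z := by
    intro z
    have hτ' := (hτ.differentiable one_ne_zero z).hasFDerivAt.mul_const δ⁻¹
    have hcomp := ((cutoffProfile.contDiff (n := 1)).differentiable one_ne_zero
      (τ z * δ⁻¹)).hasDerivAt.comp_hasFDerivAt z hτ'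
    simpa only [← div_eq_mul_inv, smul_smul, Function.comp_apply] using hcomp.const_sub 1
  have htest_int := integrable_fderiv_apply hV (hψ.mul hφ) hφc.mul_left
  have hbulk_int : Integrable fun z => (1 - cutoffProfile (τ z / δ)) * fderiv ℝ φ z (V z) :=
    (integrable_fderiv_apply hV hφ hφc).bdd_mul (c := 1) hψ.continuous.aestronglyMeasurable
      (.of_forall fun z => norm_one_sub_cutoffProfile_le _)
  have htest : ∫ z, fderiv ℝ (fun z => (1 - cutoffProfile (τ z / δ)) * φ z) z (V z) = 0 :=
    hdiv _ (hψ.mul hφ) hφc.mul_left <|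
      (tsupport_one_sub_cutoffProfile_mul_subset hτ.continuous hδ).trans
        fun z hz => ⟨hφB hz.1, hz.2⟩
  have hpointwise : ∀ z, φ z * fderiv ℝ τ z (V z) * (deriv cutoffProfile (τ z / δ) / δ) =
      (1 - cutoffProfile (τ z / δ)) * fderiv ℝ φ z (V z) -
        fderiv ℝ (fun z => (1 - cutoffProfile (τ z / δ)) * φ z) z (V z) := by
    intro z
    rw [((hψ_deriv z).fun_mul (hφ.differentiable one_ne_zero z).hasFDerivAt).fderiv]
    simp only [add_apply, smul_apply, neg_apply, smul_eq_mul]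
    ring
  simp_rw [hpointwise]
  rw [integral_sub hbulk_int htest_int, htest, sub_zero]

theorem tendsto_integral_one_sub_cutoffProfile_mul {f τ : ℂ → ℝ} (hf : Integrable f)
    (hτ : Continuous τ) (hzero : ∀ z, τ z = 0 → f z = 0) :
    Tendsto (fun δ => ∫ z, (1 - cutoffProfile (τ z / δ)) * f z) (𝓝[>] 0) (𝓝 (∫ z, f z)) := by
  have hmeas : ∀ δ, AEStronglyMeasurable (fun z => (1 - cutoffProfile (τ z / δ)) * f z) :=
    fun δ => (continuous_const.sub (cutoffProfile.continuous.comp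
      (hτ.div_const δ))).aestronglyMeasurable.mul hf.1
  refine tendsto_integral_filter_of_dominated_convergence _ (.of_forall hmeas)
    (.of_forall fun δ => .of_forall fun z => ?_) hf.norm (.of_forall fun z => ?_)
  · rw [norm_mul]
    exact mul_le_of_le_one_left (norm_nonneg _) (norm_one_sub_cutoffProfile_le _)
  · by_cases hτz : τ z = 0
    · simp [hzero z hτz]
    · refine tendsto_const_nhds.congr' ?_
      have hsmall : ∀ᶠ δ : ℝ in 𝓝[>] 0, δ < |τ z| / 2 :=
        nhdsWithin_le_nhds (Iio_mem_nhds (half_pos (abs_pos.2 hτz)))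
      filter_upwards [hsmall, self_mem_nhdsWithin] with δ hδ hδ_pos
      rw [cutoffProfile.zero_of_le_dist, sub_zero, one_mul]
      rw [dist_zero_right, Real.norm_eq_abs, abs_div, abs_of_pos (mem_Ioi.1 hδ_pos),
        le_div_iff₀ (mem_Ioi.1 hδ_pos)]
      simp only [cutoffProfile]
      linarith

theorem IsWeaklyDivFreeOn.of_chartHeight_ne_zero (hu : ‖u‖ = 1) (hg : ContDiff ℝ 1 g)
    {V : ℂ → ℂ} {B : Set ℂ} (hB : IsOpen B) (hV : LocallyIntegrable V)
    (hdiv : IsWeaklyDivFreeOn V {z ∈ B | chartHeight p u g z ≠ 0} volume)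
    (hnormal : ContinuousOn (fun z => fderiv ℝ (chartHeight p u g) z (V z)) B)
    (hzero : ∀ z ∈ B, chartHeight p u g z = 0 → V z = 0) : IsWeaklyDivFreeOn V B volume := by
  intro φ hφ hφc hφB
  have hflux_cont : Continuous fun z => φ z * fderiv ℝ (chartHeight p u g) z (V z) :=
    continuous_of_tsupport fun z hz => hφ.continuous.continuousAt.mul
      (hnormal.continuousAt (hB.mem_nhds (hφB (tsupport_mul_subset_left hz))))
  have hflux_zero : ∀ z, chartHeight p u g z = 0 →
      φ z * fderiv ℝ (chartHeight p u g) z (V z) = 0 := by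
    intro z hz
    by_cases hzφ : z ∈ tsupport φ
    · rw [hzero z (hφB hzφ) hz, map_zero, mul_zero]
    · rw [image_eq_zero_of_notMem_tsupport hzφ, zero_mul]
  have hbulk_zero : ∀ z, chartHeight p u g z = 0 → fderiv ℝ φ z (V z) = 0 := by
    intro z hz
    by_cases hzφ : z ∈ tsupport φ
    · rw [hzero z (hφB hzφ) hz, map_zero]
    · rw [fderiv_of_notMem_tsupport ℝ hzφ, zero_apply]
  have hτ := contDiff_chartHeight p u hg
  have hlayer := tendsto_integral_chartHeight_layer hu hg.continuous hflux_cont hφc.mul_right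
    hflux_zero ((cutoffProfile.contDiff (n := 1)).continuous_deriv le_rfl)
    cutoffProfile.hasCompactSupport.deriv
  refine tendsto_nhds_unique (tendsto_integral_one_sub_cutoffProfile_mul
    (integrable_fderiv_apply hV hφ hφc) hτ.continuous hbulk_zero) (hlayer.congr' ?_)
  exact eventually_mem_nhdsWithin.mono fun δ hδ =>
    (integral_one_sub_cutoffProfile_mul_fderiv hV hτ hdiv hφ hφc hφB hδ).symm

theorem abs_re_lt_and_abs_im_lt_of_mem_ball (hu : ‖u‖ = 1) (hz : z ∈ Metric.ball p r) :
    |(starRingEnd ℂ u * (z - p)).re| < r ∧ |(starRingEnd ℂ u * (z - p)).im| < r := by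
  have hnorm : ‖starRingEnd ℂ u * (z - p)‖ < r := by simpa [hu, dist_eq_norm] using hz
  exact ⟨(Complex.abs_re_le_norm _).trans_lt hnorm, (Complex.abs_im_le_norm _).trans_lt hnorm⟩

theorem add_mul_conj_mul_sub (hu : ‖u‖ = 1) (p z : ℂ) :
    p + u * (((starRingEnd ℂ u * (z - p)).re : ℂ) +
      ((starRingEnd ℂ u * (z - p)).im : ℂ) * Complex.I) = z := by
  rw [Complex.re_add_im, ← mul_assoc, Complex.mul_conj', hu]
  simp

theorem IsBoundaryChart.mem_iff_chartHeight_pos (hc : IsBoundaryChart Ω p u g r)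
    (hz : z ∈ Metric.ball p r) : z ∈ Ω ↔ 0 < chartHeight p u g z := by
  obtain ⟨hre, him⟩ := abs_re_lt_and_abs_im_lt_of_mem_ball hc.norm_eq_one hz
  have hmem := hc.mem_iff _ _ hre him
  rwa [add_mul_conj_mul_sub hc.norm_eq_one, ← sub_pos] at hmem

theorem IsBoundaryChart.mono {r' : ℝ} (hc : IsBoundaryChart Ω p u g r) (hr' : 0 < r')
    (h : r' ≤ r) : IsBoundaryChart Ω p u g r' :=
  ⟨hc.norm_eq_one, hc.contDiff, hc.map_zero, hr',
    fun s t hs ht => hc.mem_iff s t (hs.trans_le h) (ht.trans_le h)⟩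

theorem IsBoundaryChart.recenter {s r' : ℝ} (hc : IsBoundaryChart Ω p u g r) (hr' : 0 < r')
    (hs : |s| + r' ≤ r) (hgs : |g s| + r' ≤ r) :
    IsBoundaryChart Ω (p + u * ((s : ℂ) + (g s : ℂ) * Complex.I)) u
      (fun x => g (s + x) - g s) r' where
  norm_eq_one := hc.norm_eq_one
  contDiff := (hc.contDiff.comp (contDiff_const.add contDiff_id)).sub contDiff_const
  map_zero := by simp
  pos := hr'
  mem_iff a b ha hb := by
    have hsa : |s + a| < r := (abs_add_le _ _).trans_lt (by linarith)
    have hgsb : |g s + b| < r := (abs_add_le _ _).trans_lt (by linarith)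
    rw [sub_lt_iff_lt_add', ← hc.mem_iff (s + a) (g s + b) hsa hgsb]
    push_cast
    ring_nf

theorem IsBoundaryChart.exists_recenter (hc : IsBoundaryChart Ω p u g r)
    (hz : z ∈ Metric.ball p r) (hz_zero : chartHeight p u g z = 0) :
    ∃ g' r', IsBoundaryChart Ω z u g' r' ∧
      ∀ h, inner ℝ (chartNormal u g') h = fderiv ℝ (chartHeight p u g) z h := by
  obtain ⟨hre, him⟩ := abs_re_lt_and_abs_im_lt_of_mem_ball hc.norm_eq_one hz
  set s := (starRingEnd ℂ u * (z - p)).re with hs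
  have hgs : g s = (starRingEnd ℂ u * (z - p)).im := (sub_eq_zero.1 hz_zero).symm
  rw [← hgs] at him
  have hchart := hc.recenter (s := s) (r' := min (r - |s|) (r - |g s|))
    (lt_min (sub_pos.2 hre) (sub_pos.2 him))
    (by linarith [min_le_left (r - |s|) (r - |g s|)])
    (by linarith [min_le_right (r - |s|) (r - |g s|)])
  rw [hgs, hs, add_mul_conj_mul_sub hc.norm_eq_one] at hchart
  refine ⟨_, _, hchart, fun h => ?_⟩
  rw [fderiv_chartHeight_apply p u hc.contDiff]
  simp only [chartNormal, deriv_sub_const, deriv_comp_const_add, add_zero]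

theorem IsBoundaryChart.mem_frontier (hc : IsBoundaryChart Kᶜ p u g r) : p ∈ frontier K := by
  have hp : p ∈ K := by
    by_contra h
    have hpos := (hc.mem_iff_chartHeight_pos (Metric.mem_ball_self hc.pos)).1 h
    simp [chartHeight, hc.map_zero] at hpos
  have hlim : Tendsto (fun t : ℝ => p + u * (((0 : ℝ) : ℂ) + (t : ℂ) * Complex.I)) (𝓝[>] 0)
      (𝓝 p) := by
    refine (Continuous.tendsto' (by fun_prop) 0 p (by simp)).mono_left nhdsWithin_le_nhds
  rw [frontier_eq_closure_inter_closure]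
  refine ⟨subset_closure hp, mem_closure_of_tendsto hlim ?_⟩
  filter_upwards [self_mem_nhdsWithin, nhdsWithin_le_nhds (Iio_mem_nhds hc.pos)] with t ht htr
  rw [hc.mem_iff 0 t (by simpa using hc.pos) (by rwa [abs_of_pos (mem_Ioi.1 ht)]), hc.map_zero]
  exact ht

end BoundaryChart

section FlowExtension

variable {K E : Set ℂ} {v : ℂ → ℂ} {p u : ℂ} {g : ℝ → ℝ} {r C : ℝ}

theorem IsFlow.differentiableOn_complexVelocity (hK : IsClosed K) (hv : IsFlow K E v) :
    DifferentiableOn ℂ (complexVelocity v) Kᶜ := by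
  intro z hz
  have hd : DifferentiableAt ℝ v z := hv.differentiableOn.differentiableAt
    (hK.isOpen_compl.mem_nhds hz)
  have hdiv := hv.incompressible z hz
  have hcurl := hv.irrotational z hz
  unfold planeDiv at hdiv
  unfold planeCurl at hcurl
  have hw : HasFDerivAt (complexVelocity v)
      ((Complex.conjCLE : ℂ →L[ℝ] ℂ).comp (fderiv ℝ v z)) z :=
    (Complex.conjCLE : ℂ →L[ℝ] ℂ).hasFDerivAt.comp z hd.hasFDerivAt
  refine (differentiableAt_complex_iff_differentiableAt_real.2
    ⟨hw.differentiableAt, ?_⟩).differentiableWithinAt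
  rw [hw.fderiv]
  apply Complex.ext <;> simp <;> linarith

theorem conj_complexVelocity (v : ℂ → ℂ) (z : ℂ) : starRingEnd ℂ (complexVelocity v z) = v z := by
  simp [complexVelocity]

theorem IsFlow.isWeaklyDivFreeOn_compl (hK : IsClosed K) (hv : IsFlow K E v) :
    IsWeaklyDivFreeOn (Kᶜ.indicator v) Kᶜ volume :=
  (isWeaklyDivFreeOn_conj hK.isOpen_compl (hv.differentiableOn_complexVelocity hK)).congr
    fun z hz => (conj_complexVelocity v z).trans (indicator_of_mem hz v).symm

theorem IsFlow.memLp_indicator_compl (hK : IsClosed K) (hv : IsFlow K E v) (R : ℝ) :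
    MemLp (Kᶜ.indicator v) 2 (volume.restrict (Metric.ball 0 R)) := by
  have hm : MeasurableSet Kᶜ := hK.isOpen_compl.measurableSet
  rw [memLp_indicator_iff_restrict hm, Measure.restrict_restrict hm,
    memLp_two_iff_integrable_sq_norm]
  · exact hv.square_integrable R
  · exact (hv.differentiableOn.continuousOn.mono inter_subset_left).aestronglyMeasurable
      (hm.inter measurableSet_ball)

theorem IsFlow.tendsto_fderiv_chartHeight_indicator (hv : IsFlow K E v)
    (hc : IsBoundaryChart Kᶜ p u g r) (hC : ∀ z ∈ Kᶜ, z ∈ Metric.ball p r → ‖v z‖ ≤ C)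
    {z : ℂ} (hz : z ∈ Metric.ball p r) (hzE : z ∉ E) (hz_zero : chartHeight p u g z = 0) :
    Tendsto (fun y => fderiv ℝ (chartHeight p u g) y (Kᶜ.indicator v y)) (𝓝 z) (𝓝 0) := by
  obtain ⟨g', r', hchart, hnormal⟩ := hc.exists_recenter hz hz_zero
  have hslip := hv.slip z ⟨hchart.mem_frontier, hzE⟩ u g' r' hchart
  simp only [hnormal] at hslip
  have hfrozen : Tendsto (fun y => fderiv ℝ (chartHeight p u g) z (Kᶜ.indicator v y)) (𝓝 z)
      (𝓝 0) := by
    refine Metric.tendsto_nhds.2 fun ε hε => ?_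
    filter_upwards [eventually_nhdsWithin_iff.1 (Metric.tendsto_nhds.1 hslip ε hε)] with y hy
    by_cases hyK : y ∈ Kᶜ
    · rw [indicator_of_mem hyK]
      exact hy hyK
    · simpa [indicator_of_notMem hyK] using hε
  have hbounded : ∀ᶠ y in 𝓝 z, ‖Kᶜ.indicator v y‖ ≤ |C| := by
    filter_upwards [Metric.isOpen_ball.mem_nhds hz] with y hy
    by_cases hyK : y ∈ Kᶜ
    · rw [indicator_of_mem hyK]
      exact (hC y hyK hy).trans (le_abs_self C)
    · simp [indicator_of_notMem hyK]
  have hvariation : Tendsto (fun y => (fderiv ℝ (chartHeight p u g) y -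
      fderiv ℝ (chartHeight p u g) z) (Kᶜ.indicator v y)) (𝓝 z) (𝓝 0) := by
    have hcont := ((contDiff_chartHeight p u hc.contDiff).continuous_fderiv one_ne_zero).tendsto z
    have hsmall := ((hcont.sub_const (fderiv ℝ (chartHeight p u g) z)).norm.mul_const |C|)
    rw [sub_self, norm_zero, zero_mul] at hsmall
    refine squeeze_zero_norm' ?_ hsmall
    filter_upwards [hbounded] with y hy
    exact ContinuousLinearMap.le_opNorm_of_le _ hy
  simpa using hvariation.add hfrozen

theorem IsFlow.continuousOn_fderiv_chartHeight_indicator (hK : IsClosed K) (hv : IsFlow K E v)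
    (hc : IsBoundaryChart Kᶜ p u g r) (hC : ∀ z ∈ Kᶜ, z ∈ Metric.ball p r → ‖v z‖ ≤ C)
    (hE : Disjoint (Metric.ball p r) E) :
    ContinuousOn (fun z => fderiv ℝ (chartHeight p u g) z (Kᶜ.indicator v z))
      (Metric.ball p r) := by
  have hτ := contDiff_chartHeight p u hc.contDiff
  refine fun z hz => ContinuousAt.continuousWithinAt ?_
  rcases lt_trichotomy (chartHeight p u g z) 0 with hneg | hzero | hpos
  · refine (continuousAt_const (y := (0 : ℝ))).congr ?_
    filter_upwards [Metric.isOpen_ball.mem_nhds hz,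
      (hτ.continuous.continuousAt (x := z)).eventually_lt continuousAt_const hneg] with y hy hy_neg
    rw [indicator_of_notMem, map_zero]
    rw [hc.mem_iff_chartHeight_pos hy]
    exact hy_neg.not_gt
  · have hzK : z ∉ Kᶜ := by simp [hc.mem_iff_chartHeight_pos hz, hzero]
    rw [ContinuousAt, indicator_of_notMem hzK, map_zero]
    exact hv.tendsto_fderiv_chartHeight_indicator hc hC hz (hE.notMem_of_mem_left hz) hzero
  · have hzK : Kᶜ ∈ 𝓝 z := hK.isOpen_compl.mem_nhds ((hc.mem_iff_chartHeight_pos hz).2 hpos)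
    have hv_cont := (hv.differentiableOn.continuousOn.congr
      fun y hy => indicator_of_mem hy v).continuousAt hzK
    exact (hτ.continuous_fderiv one_ne_zero).continuousAt.clm_apply hv_cont

theorem IsFlow.isWeaklyDivFreeOn_ball (hK : IsClosed K) (hv : IsFlow K E v)
    (hc : IsBoundaryChart Kᶜ p u g r) (hC : ∀ z ∈ Kᶜ, z ∈ Metric.ball p r → ‖v z‖ ≤ C)
    (hE : Disjoint (Metric.ball p r) E) :
    IsWeaklyDivFreeOn (Kᶜ.indicator v) (Metric.ball p r) volume := by
  have hloc : LocallyIntegrable (Kᶜ.indicator v) :=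
    locallyIntegrable_of_memLp_two_ball (hv.memLp_indicator_compl hK)
  have hτ := (contDiff_chartHeight p u hc.contDiff).continuous
  refine .of_chartHeight_ne_zero hc.norm_eq_one hc.contDiff Metric.isOpen_ball hloc ?_
    (hv.continuousOn_fderiv_chartHeight_indicator hK hc hC hE) fun z hz hz_zero => ?_
  · refine ((hv.isWeaklyDivFreeOn_compl hK).union hloc hK.isOpen_compl
      (Metric.isOpen_ball.inter (isOpen_lt hτ continuous_const))
      (isWeaklyDivFreeOn_of_eqOn_zero (U := Metric.ball p r ∩ {z | chartHeight p u g z < 0})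
        fun z hz => ?_)).mono fun z hz => ?_
    · refine indicator_of_notMem ?_ v
      rw [hc.mem_iff_chartHeight_pos hz.1]
      exact (show chartHeight p u g z < 0 from hz.2).not_gt
    · rcases hz.2.lt_or_gt with hneg | hpos
      · exact Or.inr ⟨hz.1, hneg⟩
      · exact Or.inl ((hc.mem_iff_chartHeight_pos hz.1).2 hpos)
  · refine indicator_of_notMem ?_ v
    simp [hc.mem_iff_chartHeight_pos hz, hz_zero]

theorem IsFlow.isWeaklyDivFreeOn_univ (hK : IsBody K E) (hv : IsFlow K E v) :
    IsWeaklyDivFreeOn (Kᶜ.indicator v) univ volume := by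
  have hclosed : IsClosed K := hK.isCompact.isClosed
  have hLp := hv.memLp_indicator_compl hclosed
  refine .univ_of_compl_finite hK.finite_corners hLp
    (.of_locally (locallyIntegrable_of_memLp_two_ball hLp) fun x hx => ?_)
  by_cases hxK : x ∈ K
  swap
  · exact ⟨Kᶜ, hclosed.isOpen_compl, hxK, hv.isWeaklyDivFreeOn_compl hclosed⟩
  by_cases hx_int : x ∈ interior K
  · exact ⟨interior K, isOpen_interior, hx_int, isWeaklyDivFreeOn_of_eqOn_zero fun z hz =>
      indicator_of_notMem (notMem_compl_iff.2 (interior_subset hz)) v⟩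
  · have hx_regular : x ∈ frontier K \ E := ⟨⟨subset_closure hxK, hx_int⟩, hx⟩
    obtain ⟨u, g, r, hc⟩ := hK.exists_chart x hx_regular
    obtain ⟨r₁, hr₁, C, hC⟩ := hv.bounded_near_regular x hx_regular
    obtain ⟨r₂, hr₂, hE⟩ := Metric.isOpen_iff.1 hK.finite_corners.isClosed.isOpen_compl x hx
    have hρ : 0 < min r (min r₁ r₂) := lt_min hc.pos (lt_min hr₁ hr₂)
    refine ⟨Metric.ball x (min r (min r₁ r₂)), Metric.isOpen_ball, Metric.mem_ball_self hρ,
      hv.isWeaklyDivFreeOn_ball hclosed (hc.mono hρ (min_le_left _ _)) (C := C)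
        (fun z hzK hz => hC z hzK ?_) ?_⟩
    · exact (Metric.mem_ball.1 hz).trans_le ((min_le_right _ _).trans (min_le_left _ _))
    · exact (subset_compl_iff_disjoint_right.1 hE).mono_left
        (Metric.ball_subset_ball ((min_le_right _ _).trans (min_le_right _ _)))

end FlowExtension

/-! ### Stream functions of weakly divergence-free fields -/

/-- The flux form: `fluxForm a h` is the flux of the constant field `a` across the segment `h`,
so that `F` is a stream function of `V` when its derivative at `z` is `fluxForm (V z)`. -/
noncomputable def fluxForm : ℂ →L[ℝ] ℂ →L[ℝ] ℝ :=
  (ContinuousLinearMap.compL ℝ ℂ ℂ ℝ Complex.imCLM).comp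
    ((ContinuousLinearMap.mul ℝ ℂ).comp (Complex.conjCLE : ℂ →L[ℝ] ℂ))

theorem fluxForm_apply (a h : ℂ) : fluxForm a h = ((starRingEnd ℂ) a * h).im := by
  simp [fluxForm]

theorem norm_fluxForm_le (a : ℂ) : ‖fluxForm a‖ ≤ ‖a‖ := by
  refine ContinuousLinearMap.opNorm_le_bound _ (norm_nonneg _) fun h => ?_
  rw [fluxForm_apply]
  exact (Complex.abs_im_le_norm _).trans (by simp)

theorem fluxForm_self_mul_I (a : ℂ) : fluxForm a (Complex.I * a) = ‖a‖ ^ 2 := by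
  rw [fluxForm_apply, ← Complex.normSq_eq_norm_sq, Complex.normSq_apply]
  simp

theorem fluxForm_eq_zero_iff {a : ℂ} : fluxForm a = 0 ↔ a = 0 := by
  refine ⟨fun h => ?_, fun h => by rw [h, map_zero]⟩
  simpa [h] using (fluxForm_self_mul_I a).symm

section StreamFunction

open scoped Convolution

variable {V : ℂ → ℂ} {z z₀ : ℂ}

theorem IsWeaklyDivFreeOn.planeDiv_convolution_eq_zero {f : ℂ → ℝ}
    (hdiv : IsWeaklyDivFreeOn V univ volume) (hV : LocallyIntegrable V) (hf : ContDiff ℝ 1 f)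
    (hfc : HasCompactSupport f) (z : ℂ) :
    planeDiv (f ⋆[ContinuousLinearMap.lsmul ℝ ℝ, volume] V) z = 0 := by
  have hex := (hfc.fderiv (𝕜 := ℝ)).convolutionExists_left
    ((ContinuousLinearMap.lsmul ℝ ℝ : ℝ →L[ℝ] ℂ →L[ℝ] ℂ).precompL ℂ)
    (hf.continuous_fderiv one_ne_zero) hV z
  have hint (h : ℂ) : Integrable fun t => fderiv ℝ f (z - t) h • V t :=
    hex.integrable_swap.apply_continuousLinearMap h
  have happ (h : ℂ) : fderiv ℝ (f ⋆[ContinuousLinearMap.lsmul ℝ ℝ, volume] V) z h =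
      ∫ t, fderiv ℝ f (z - t) h • V t := by
    rw [(hfc.hasFDerivAt_convolution_left _ hf hV z).fderiv, convolution_eq_swap,
      ContinuousLinearMap.integral_apply hex.integrable_swap]
    rfl
  have htest (t : ℂ) : fderiv ℝ (fun t => f (z - t)) t = -fderiv ℝ f (z - t) := by
    have hd := ((hf.differentiable one_ne_zero (z - t)).hasFDerivAt).comp t
      ((hasFDerivAt_id t).const_sub z)
    simpa only [Function.comp_def, id_eq, ContinuousLinearMap.comp_neg,
      ContinuousLinearMap.comp_id] using hd.fderiv
  calc planeDiv (f ⋆[ContinuousLinearMap.lsmul ℝ ℝ, volume] V) z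
      = (∫ t, (fderiv ℝ f (z - t) 1 • V t).re) +
          ∫ t, (fderiv ℝ f (z - t) Complex.I • V t).im := by
        rw [planeDiv, happ, happ]
        exact congrArg₂ _ (integral_re (hint 1)).symm (integral_im (hint Complex.I)).symm
    _ = ∫ t, ((fderiv ℝ f (z - t) 1 • V t).re + (fderiv ℝ f (z - t) Complex.I • V t).im) :=
        (integral_add (hint 1).re (hint Complex.I).im).symm
    _ = -∫ t, fderiv ℝ (fun t => f (z - t)) t (V t) := by
        rw [← integral_neg]
        refine integral_congr_ae (Eventually.of_forall fun t => ?_)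
        simp only [htest, neg_apply, neg_neg]
        rw [clm_apply_eq_re_mul_add_im_mul (fderiv ℝ f (z - t)) (V t)]
        simp [mul_comm]
    _ = 0 := neg_eq_zero.2 <| hdiv _ (hf.comp (contDiff_const.sub contDiff_id))
        (hfc.comp_homeomorph (Homeomorph.subLeft z)) (subset_univ _)

theorem exists_hasFDerivAt_fluxForm (hV : Differentiable ℝ V) (hdiv : ∀ z, planeDiv V z = 0)
    (z₀ : ℂ) : ∃ F : ℂ → ℝ, F z₀ = 0 ∧ ∀ z, HasFDerivAt F (fluxForm (V z)) z := by
  have hd (z : ℂ) : HasFDerivAt (fun z => fluxForm (V z)) (fluxForm.comp (fderiv ℝ V z)) z :=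
    fluxForm.hasFDerivAt.comp z (hV z).hasFDerivAt
  have hlin (z h : ℂ) :
      fderiv ℝ V z h = h.re • fderiv ℝ V z 1 + h.im • fderiv ℝ V z Complex.I := by
    rw [← map_smul, ← map_smul, ← map_add]
    congr 1
    simp
  have hsymm (z h k : ℂ) : fluxForm (fderiv ℝ V z h) k = fluxForm (fderiv ℝ V z k) h := by
    have hz := hdiv z
    unfold planeDiv at hz
    rw [hlin z h, hlin z k, fluxForm_apply, fluxForm_apply]
    simp only [map_add, Complex.add_im, Complex.mul_im, Complex.add_re, Complex.real_smul, map_mul,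
      Complex.conj_ofReal, Complex.re_ofReal_mul, Complex.ofReal_im, Complex.conj_re,
      Complex.conj_im]
    linear_combination (h.re * k.im - h.im * k.re) * hz
  obtain ⟨F, hF⟩ := convex_univ.exists_forall_hasFDerivAt_of_fderiv_symmetric isOpen_univ
    (fun z _ => (hd z).differentiableAt.differentiableWithinAt) fun z _ h k => by
      rw [(hd z).fderiv]
      exact hsymm z h k
  exact ⟨fun z => F z - F z₀, sub_self _, fun z => (hF z trivial).sub_const _⟩

/-- The points near which `V` is bounded. -/
def locallyBoundedSet (V : ℂ → ℂ) : Set ℂ :=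
  {z | ∃ C : ℝ, ∀ᶠ y in 𝓝 z, ‖V y‖ ≤ C}

theorem isOpen_locallyBoundedSet (V : ℂ → ℂ) : IsOpen (locallyBoundedSet V) :=
  isOpen_iff_eventually.2 fun _ ⟨C, hC⟩ => hC.eventually_nhds.mono fun _ hy => ⟨C, hy⟩

theorem mem_locallyBoundedSet_of_continuousAt (h : ContinuousAt V z) : z ∈ locallyBoundedSet V :=
  ⟨‖V z‖ + 1, (h.norm.eventually_lt_const (lt_add_one _)).mono fun _ hy => hy.le⟩

/-- Smooth bump functions whose supports shrink to the origin. -/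
noncomputable def mollifier (n : ℕ) : ContDiffBump (0 : ℂ) where
  rIn := 1 / ((n : ℝ) + 1) / 2
  rOut := 1 / ((n : ℝ) + 1)
  rIn_pos := by positivity
  rIn_lt_rOut := half_lt_self (by positivity)

theorem tendsto_rOut_mollifier : Tendsto (fun n => (mollifier n).rOut) atTop (𝓝 0) :=
  tendsto_one_div_add_atTop_nhds_zero_nat

/-- The smoothing of the field `V` at scale `1 / (n + 1)`. -/
noncomputable def mollify (V : ℂ → ℂ) (n : ℕ) : ℂ → ℂ :=
  (mollifier n).normed volume ⋆[ContinuousLinearMap.lsmul ℝ ℝ, volume] V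

theorem tendsto_mollify_of_continuousAt (hV : AEStronglyMeasurable V) (hz : ContinuousAt V z) :
    Tendsto (fun q : ℕ × ℂ => mollify V q.1 q.2) (atTop ×ˢ 𝓝 z) (𝓝 (V z)) :=
  ContDiffBump.convolution_tendsto_right (g := fun _ => V) (k := Prod.snd)
    (tendsto_rOut_mollifier.comp tendsto_fst) (Eventually.of_forall fun _ => hV)
    (hz.tendsto.comp tendsto_snd) tendsto_snd

theorem eventually_norm_mollify_le (hV : AEStronglyMeasurable V) {C : ℝ}
    (hC : ∀ᶠ y in 𝓝 z, ‖V y‖ ≤ C) :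
    ∀ᶠ q : ℕ × ℂ in atTop ×ˢ 𝓝 z, ‖mollify V q.1 q.2‖ ≤ C := by
  obtain ⟨r, hr, hball⟩ := Metric.eventually_nhds_iff_ball.1 hC
  filter_upwards [(tendsto_rOut_mollifier.eventually_lt_const (half_pos hr)).prod_mk
    (Metric.ball_mem_nhds z (half_pos hr))] with q ⟨hn, hy⟩
  rw [← dist_zero_right]
  refine dist_convolution_le ((norm_nonneg _).trans (hball z (Metric.mem_ball_self hr)))
    (mollifier q.1).support_normed_eq.subset (mollifier q.1).nonneg_normed
    (mollifier q.1).integral_normed hV fun x hx => ?_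
  rw [dist_zero_right]
  refine hball x (Metric.mem_ball.2 ?_)
  linarith [dist_triangle x q.2 z, Metric.mem_ball.1 hx, Metric.mem_ball.1 hy]

theorem IsWeaklyDivFreeOn.exists_hasFDerivAt_mollify (hdiv : IsWeaklyDivFreeOn V univ volume)
    (hV : LocallyIntegrable V) (n : ℕ) (z₀ : ℂ) :
    ∃ F : ℂ → ℝ, F z₀ = 0 ∧ ∀ z, HasFDerivAt F (fluxForm (mollify V n z)) z := by
  have hsmooth : ContDiff ℝ 1 ((mollifier n).normed volume) := (mollifier n).contDiff_normed
  have hcompact : HasCompactSupport ((mollifier n).normed volume) :=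
    (mollifier n).hasCompactSupport_normed
  exact exists_hasFDerivAt_fluxForm
    (fun z => (hcompact.hasFDerivAt_convolution_left _ hsmooth hV z).differentiableAt)
    (hdiv.planeDiv_convolution_eq_zero hV hsmooth hcompact) z₀

theorem eventually_abs_sub_le_of_hasFDerivAt_mollify {F : ℕ → ℂ → ℝ} {C : ℝ}
    (hV : AEStronglyMeasurable V) (hF : ∀ n z, HasFDerivAt (F n) (fluxForm (mollify V n z)) z)
    (hC : ∀ᶠ y in 𝓝 z, ‖V y‖ ≤ C) :
    ∀ᶠ y in 𝓝 z, ∀ᶠ n in atTop, |F n y - F n z| ≤ C * ‖y - z‖ := by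
  obtain ⟨large, hlarge, near, hnear, hbound⟩ :=
    eventually_prod_iff.1 (eventually_norm_mollify_le hV hC)
  obtain ⟨r, hr, hball⟩ := Metric.eventually_nhds_iff_ball.1 hnear
  filter_upwards [Metric.ball_mem_nhds z hr] with y hy
  filter_upwards [hlarge] with n hn
  exact (convex_ball z r).norm_image_sub_le_of_norm_hasFDerivWithin_le
    (fun x _ => (hF n x).hasFDerivWithinAt)
    (fun x hx => (norm_fluxForm_le _).trans (hbound hn (hball x hx)))
    (Metric.mem_ball_self hr) hy

theorem exists_ultrafilter_forall_tendsto {α : Type*} [TopologicalSpace α] {U : Set α}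
    (hU : IsPreconnected U) {F : ℕ → α → ℝ} {x₀ : α} (hx₀ : x₀ ∈ U) (hF₀ : ∀ n, F n x₀ = 0)
    (hF : ∀ x ∈ U, ∀ᶠ y in 𝓝 x, ∃ M : ℝ, ∀ᶠ n in atTop, |F n y - F n x| ≤ M) :
    ∃ (l : Ultrafilter ℕ) (G : α → ℝ), ↑l ≤ (atTop : Filter ℕ) ∧
      ∀ x ∈ U, Tendsto (fun n => F n x) l (𝓝 (G x)) := by
  have hbounded : ∀ x ∈ U, ∃ M : ℝ, ∀ᶠ n in atTop, |F n x| ≤ M := by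
    intro x hx
    have hdiff := hU.induction₂ (fun x y => ∃ M : ℝ, ∀ᶠ n in atTop, |F n y - F n x| ≤ M)
      (fun x hx => (hF x hx).filter_mono nhdsWithin_le_nhds)
      (fun x y z _ _ _ ⟨M, hM⟩ ⟨M', hM'⟩ => ⟨M' + M, (hM.and hM').mono fun n hn =>
        (abs_sub_le _ (F n y) _).trans (add_le_add hn.2 hn.1)⟩)
      (fun x y _ _ ⟨M, hM⟩ => ⟨M, hM.mono fun n hn => by rwa [abs_sub_comm]⟩) hx₀ hx
    simpa only [hF₀, sub_zero] using hdiff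
  have hlimit (x : α) : ∃ a : ℝ, x ∈ U →
      Tendsto (fun n => F n x) (Ultrafilter.of (atTop : Filter ℕ)) (𝓝 a) := by
    by_cases hx : x ∈ U
    · obtain ⟨M, hM⟩ := hbounded x hx
      obtain ⟨a, -, ha⟩ := (isCompact_Icc (a := -M) (b := M)).ultrafilter_le_nhds
        ((Ultrafilter.of atTop).map fun n => F n x) (le_principal_iff.2
          ((hM.filter_mono (Ultrafilter.of_le _)).mono fun n hn => abs_le.1 hn))
      exact ⟨a, fun _ => ha⟩
    · exact ⟨0, fun h => absurd h hx⟩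
  choose G hG using hlimit
  exact ⟨Ultrafilter.of atTop, G, Ultrafilter.of_le _, hG⟩

/-- Normalised at `z₀`, the stream functions of the mollified fields stay bounded at each point of
`locallyBoundedSet V`, hence converge along an ultrafilter. -/
theorem IsWeaklyDivFreeOn.exists_streamFunction (hdiv : IsWeaklyDivFreeOn V univ volume)
    (hV : LocallyIntegrable V) (hB : IsPreconnected (locallyBoundedSet V))
    (hz₀ : z₀ ∈ locallyBoundedSet V) :
    ∃ F : ℂ → ℝ, F z₀ = 0 ∧
      (∀ z ∈ locallyBoundedSet V, (fun y => F y - F z) =O[𝓝 z] fun y => y - z) ∧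
      ∀ z, ContinuousAt V z → HasFDerivAt F (fluxForm (V z)) z := by
  have hVm := hV.aestronglyMeasurable
  choose F hF₀ hF using fun n => hdiv.exists_hasFDerivAt_mollify hV n z₀
  obtain ⟨l, G, hl, hG⟩ := exists_ultrafilter_forall_tendsto hB hz₀ hF₀ fun z ⟨C, hC⟩ =>
    (eventually_abs_sub_le_of_hasFDerivAt_mollify hVm hF hC).mono fun y hy => ⟨_, hy⟩
  refine ⟨G, ?_, fun z hz => ?_, fun z hz => ?_⟩
  · simpa [hF₀, tendsto_const_nhds_iff, eq_comm] using hG z₀ hz₀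
  · obtain ⟨C, hC⟩ := id hz
    refine Asymptotics.IsBigO.of_bound C ?_
    filter_upwards [eventually_abs_sub_le_of_hasFDerivAt_mollify hVm hF hC,
      (isOpen_locallyBoundedSet V).mem_nhds hz] with y hy hyB
    exact le_of_tendsto ((hG y hyB).sub (hG z hz)).abs (hy.filter_mono hl)
  · refine hasFDerivAt_of_tendstoUniformlyOnFilter (𝕜 := ℝ) (l := (l : Filter ℕ))
      (f' := fun n y => fluxForm (mollify V n y)) (g' := fun y => fluxForm (V y)) ?_
      (Eventually.of_forall fun q => hF q.1 q.2) ?_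
    · rw [tendstoUniformlyOnFilter_iff_tendsto]
      have hlimit : Tendsto (fun q : ℕ × ℂ => V q.2) (↑l ×ˢ 𝓝 z) (𝓝 (V z)) :=
        hz.tendsto.comp tendsto_snd
      have happrox := (tendsto_mollify_of_continuousAt hVm hz).mono_left (prod_mono_left _ hl)
      exact (((fluxForm.continuous.tendsto _).comp hlimit).prodMk_nhds
        ((fluxForm.continuous.tendsto _).comp happrox)).mono_right (nhds_le_uniformity _)
    · filter_upwards [(isOpen_locallyBoundedSet V).mem_nhds
        (mem_locallyBoundedSet_of_continuousAt hz)] with y hy using hG y hy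

end StreamFunction

/-! ### Stream functions of flows and the energy argument -/

/-- A stream function of the flow `v` around `K`, vanishing on the body: it is required to be
`O(y - z)` at the points `z` of the body near which the velocity is bounded. -/
structure IsStreamFunction (K : Set ℂ) (v : ℂ → ℂ) (F : ℂ → ℝ) : Prop where
  hasFDerivAt : ∀ z ∈ Kᶜ, HasFDerivAt F (fluxForm (v z)) z
  isBigO : ∀ z ∈ K, VelocityBoundedNear K v z → F =O[𝓝 z] fun y => y - z

section FlowStreamFunction

variable {K E : Set ℂ} {v : ℂ → ℂ} {F : ℂ → ℝ} {z : ℂ}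

theorem VelocityBoundedNear.mem_locallyBoundedSet_indicator (h : VelocityBoundedNear K v z) :
    z ∈ locallyBoundedSet (Kᶜ.indicator v) := by
  obtain ⟨r, hr, C, hC⟩ := h
  refine ⟨|C|, ?_⟩
  filter_upwards [Metric.ball_mem_nhds z hr] with y hy
  by_cases hyK : y ∈ Kᶜ
  · rw [indicator_of_mem hyK]
    exact (hC y hyK hy).trans (le_abs_self C)
  · rw [indicator_of_notMem hyK, norm_zero]
    exact abs_nonneg C

theorem IsFlow.velocityBoundedNear_of_notMem (hv : IsFlow K E v) (hzK : z ∈ K) (hz : z ∉ E) :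
    VelocityBoundedNear K v z := by
  by_cases hz_int : z ∈ interior K
  · obtain ⟨r, hr, hsub⟩ := Metric.isOpen_iff.1 isOpen_interior z hz_int
    exact ⟨r, hr, 0, fun y hy hyr => absurd (interior_subset (hsub hyr)) hy⟩
  · exact hv.bounded_near_regular z ⟨⟨subset_closure hzK, hz_int⟩, hz⟩

theorem continuousAt_indicator_compl_of_mem_interior (hz : z ∈ interior K) :
    ContinuousAt (Kᶜ.indicator v) z :=
  continuousAt_const.congr <| by
    filter_upwards [isOpen_interior.mem_nhds hz] with y hy
    exact (indicator_of_notMem (notMem_compl_iff.2 (interior_subset hy)) v).symm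

theorem IsFlow.continuousAt_indicator_compl (hK : IsClosed K) (hv : IsFlow K E v) (hz : z ∈ Kᶜ) :
    ContinuousAt (Kᶜ.indicator v) z :=
  (hv.differentiableOn.continuousOn.congr fun _ hy => indicator_of_mem hy v).continuousAt
    (hK.isOpen_compl.mem_nhds hz)

theorem IsFlow.isPreconnected_locallyBoundedSet_indicator (hK : IsBody K E) (hv : IsFlow K E v) :
    IsPreconnected (locallyBoundedSet (Kᶜ.indicator v)) := by
  have hsub : (locallyBoundedSet (Kᶜ.indicator v))ᶜ ⊆ E := by
    refine compl_subset_comm.1 fun z hzE => ?_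
    by_cases hzK : z ∈ K
    · exact (hv.velocityBoundedNear_of_notMem hzK hzE).mem_locallyBoundedSet_indicator
    · exact mem_locallyBoundedSet_of_continuousAt
        (hv.continuousAt_indicator_compl hK.isCompact.isClosed hzK)
  rw [← compl_compl (locallyBoundedSet _)]
  exact ((hK.finite_corners.subset hsub).countable.isConnected_compl_of_one_lt_rank
    (by simp)).isPreconnected

theorem IsFlow.exists_isStreamFunction (hK : IsBody K E) (hv : IsFlow K E v) :
    ∃ F, IsStreamFunction K v F := by
  have hclosed : IsClosed K := hK.isCompact.isClosed
  obtain ⟨z₀, hz₀⟩ := hK.isConnected_interior.nonempty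
  obtain ⟨F, hF₀, hFO, hFd⟩ := (hv.isWeaklyDivFreeOn_univ hK).exists_streamFunction
    (locallyIntegrable_of_memLp_two_ball (hv.memLp_indicator_compl hclosed))
    (hv.isPreconnected_locallyBoundedSet_indicator hK)
    (mem_locallyBoundedSet_of_continuousAt (continuousAt_indicator_compl_of_mem_interior hz₀))
  have hinterior : ∀ z ∈ interior K, F z = 0 := by
    have hd : ∀ z ∈ interior K, HasFDerivAt F (0 : ℂ →L[ℝ] ℝ) z := by
      intro z hz
      have hFz := hFd z (continuousAt_indicator_compl_of_mem_interior hz)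
      rwa [indicator_of_notMem (notMem_compl_iff.2 (interior_subset hz)), map_zero] at hFz
    intro z hz
    rw [← hF₀]
    exact isOpen_interior.is_const_of_fderiv_eq_zero hK.isConnected_interior.isPreconnected
      (fun z hz => (hd z hz).differentiableAt.differentiableWithinAt)
      (fun z hz => (hd z hz).fderiv) hz hz₀
  refine ⟨F, fun z hz => ?_, fun z hzK hbdd => ?_⟩
  · simpa only [indicator_of_mem hz] using hFd z (hv.continuousAt_indicator_compl hclosed hz)
  · have hFz_O := hFO z hbdd.mem_locallyBoundedSet_indicator
    have hcont : Tendsto F (𝓝 z) (𝓝 (F z)) := tendsto_sub_nhds_zero_iff.1 <|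
      hFz_O.trans_tendsto (tendsto_sub_nhds_zero_iff.2 tendsto_id)
    have hFz : F z = 0 := by
      have : (𝓝[interior K] z).NeBot :=
        mem_closure_iff_nhdsWithin_neBot.1 (hK.closure_interior.symm ▸ hzK)
      exact tendsto_nhds_unique (hcont.mono_left nhdsWithin_le_nhds)
        (tendsto_const_nhds.congr' (eventually_mem_nhdsWithin.mono fun y hy =>
          (hinterior y hy).symm))
    simpa only [hFz, sub_zero] using hFz_O

theorem IsStreamFunction.neg (hF : IsStreamFunction K v F) :
    IsStreamFunction K (-v) (-F) where
  hasFDerivAt z hz := by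
    rw [Pi.neg_apply, map_neg]
    exact (hF.hasFDerivAt z hz).neg
  isBigO z hz hb :=
    (hF.isBigO z hz (by simpa only [VelocityBoundedNear, Pi.neg_apply, norm_neg] using hb)).neg_left

theorem IsStreamFunction.contDiffOn (hK : IsClosed K) (hF : IsStreamFunction K v F)
    (hv : ContinuousOn v Kᶜ) : ContDiffOn ℝ 1 F Kᶜ := by
  rw [← zero_add (1 : WithTop ℕ∞), contDiffOn_succ_iff_fderiv_of_isOpen hK.isOpen_compl]
  refine ⟨fun z hz => (hF.hasFDerivAt z hz).differentiableAt.differentiableWithinAt, by simp,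
    contDiffOn_zero.2 ?_⟩
  exact (fluxForm.continuous.comp_continuousOn hv).congr fun z hz => (hF.hasFDerivAt z hz).fderiv

theorem IsStreamFunction.eqOn_zero_of_eqOn_const (hK : IsClosed K) (hF : IsStreamFunction K v F)
    {c : ℝ} (hc : EqOn F (fun _ => c) Kᶜ) : EqOn v 0 Kᶜ := fun z hz =>
  fluxForm_eq_zero_iff.1 <| (hF.hasFDerivAt z hz).unique <|
    (hasFDerivAt_const c z).congr_of_eventuallyEq
      (hc.eventuallyEq_of_mem (hK.isOpen_compl.mem_nhds hz))

end FlowStreamFunction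

theorem ae_eq_zero_of_tendsto_integral_norm {α E : Type*} {m : MeasurableSpace α} {μ : Measure α}
    [NormedAddCommGroup E] {f : ℕ → α → E} {g : α → E} (hf : ∀ n, Integrable (f n) μ)
    (hlim : Tendsto (fun n => ∫ x, ‖f n x‖ ∂μ) atTop (𝓝 0))
    (hfg : ∀ᵐ x ∂μ, Tendsto (fun n => f n x) atTop (𝓝 (g x))) : g =ᵐ[μ] 0 := by
  have hL1 : Tendsto (fun n => eLpNorm (f n - 0) 1 μ) atTop (𝓝 0) := by
    simp only [sub_zero, eLpNorm_one_eq_lintegral_enorm, ← ofReal_integral_norm_eq_lintegral_enorm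
      (hf _)]
    simpa using ENNReal.tendsto_ofReal hlim
  obtain ⟨ns, hns, hsub⟩ := (tendstoInMeasure_of_tendsto_eLpNorm one_ne_zero
    (fun n => (hf n).aestronglyMeasurable) aestronglyMeasurable_zero hL1).exists_seq_tendsto_ae
  filter_upwards [hfg, hsub] with x hx hx_sub
  exact tendsto_nhds_unique (hx.comp hns.tendsto_atTop) hx_sub

section Energy

variable {K E : Set ℂ} {v : ℂ → ℂ} {F : ℂ → ℝ} {T : ℝ → ℝ} {c M : ℝ}

theorem IsStreamFunction.comp_eventuallyEq_zero (hF : IsStreamFunction K v F) (hc : c < 0)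
    (hT : ∀ y, c ≤ y → T y = 0) {z : ℂ} (hz : z ∈ K) (hbdd : VelocityBoundedNear K v z) :
    (fun y => T (F y)) =ᶠ[𝓝 z] 0 := by
  have hlim : Tendsto F (𝓝 z) (𝓝 0) :=
    (hF.isBigO z hz hbdd).trans_tendsto (tendsto_sub_nhds_zero_iff.2 tendsto_id)
  exact (hlim.eventually_const_lt hc).mono fun y hy => hT _ hy.le

theorem IsStreamFunction.mul_comp_eventuallyEq_zero (hv : IsFlow K E v)
    (hF : IsStreamFunction K v F) (hc : c < 0) (hT : ∀ y, c ≤ y → T y = 0) {χ : ℂ → ℝ}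
    (hχE : Disjoint (tsupport χ) E) {z : ℂ} (hz : z ∈ K) : (fun y => χ y * T (F y)) =ᶠ[𝓝 z] 0 := by
  by_cases hzE : z ∈ E
  · filter_upwards [notMem_tsupport_iff_eventuallyEq.1 (hχE.notMem_of_mem_right hzE)] with y hy
    simp [hy]
  · filter_upwards [hF.comp_eventuallyEq_zero hc hT hz (hv.velocityBoundedNear_of_notMem hz hzE)]
      with y hy
    simpa using Or.inr hy

theorem IsStreamFunction.contDiff_mul_comp (hK : IsClosed K) (hv : IsFlow K E v)
    (hF : IsStreamFunction K v F) (hc : c < 0) (hT : ∀ y, c ≤ y → T y = 0) (hT₁ : ContDiff ℝ 1 T)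
    {χ : ℂ → ℝ} (hχ : ContDiff ℝ 1 χ) (hχE : Disjoint (tsupport χ) E) :
    ContDiff ℝ 1 fun z => χ z * T (F z) := by
  refine contDiff_iff_contDiffAt.2 fun z => ?_
  by_cases hz : z ∈ K
  · exact contDiffAt_const.congr_of_eventuallyEq (hF.mul_comp_eventuallyEq_zero hv hc hT hχE hz)
  · exact hχ.contDiffAt.mul (hT₁.contDiffAt.comp z
      ((hF.contDiffOn hK hv.differentiableOn.continuousOn).contDiffAt
        (hK.isOpen_compl.mem_nhds hz)))

theorem IsStreamFunction.fderiv_mul_comp_apply (hF : IsStreamFunction K v F)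
    (hT : Differentiable ℝ T) {χ : ℂ → ℝ} (hχ : Differentiable ℝ χ) (z : ℂ) :
    fderiv ℝ (fun z => χ z * T (F z)) z (Complex.I * Kᶜ.indicator v z) =
      χ z * (deriv T (F z) * ‖Kᶜ.indicator v z‖ ^ 2) +
        fderiv ℝ χ z (T (F z) • (Complex.I * Kᶜ.indicator v z)) := by
  by_cases hz : z ∈ Kᶜ
  · have hcomp := (hT (F z)).hasDerivAt.comp_hasFDerivAt z (hF.hasFDerivAt z hz)
    have hprod : HasFDerivAt (fun z => χ z * T (F z)) _ z := (hχ z).hasFDerivAt.fun_mul hcomp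
    rw [hprod.fderiv]
    simp only [indicator_of_mem hz, add_apply, smul_apply, smul_eq_mul, map_smul,
      fluxForm_self_mul_I]
  · simp [indicator_of_notMem hz]

theorem IsStreamFunction.memLp_comp_smul (hK : IsClosed K) (hv : ContinuousOn v Kᶜ)
    (hF : IsStreamFunction K v F) (hT : ∀ y, c ≤ y → T y = 0) (hTc : Continuous T)
    (hM : ∀ y, |T y| ≤ M) (hen : IntegrableOn (fun z => ‖v z‖ ^ 2) (Kᶜ ∩ {z | F z < c})) :
    MemLp (fun z => T (F z) • (Complex.I * Kᶜ.indicator v z)) 2 := by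
  have hFc := (hF.contDiffOn hK hv).continuousOn
  have hm : MeasurableSet (Kᶜ ∩ {z | F z < c}) :=
    (hFc.isOpen_inter_preimage hK.isOpen_compl isOpen_Iio).measurableSet
  have hindicator : (fun z => T (F z) • (Complex.I * Kᶜ.indicator v z)) =
      (Kᶜ ∩ {z | F z < c}).indicator fun z => T (F z) • (Complex.I * v z) := by
    ext z
    by_cases hz : z ∈ Kᶜ
    · by_cases hzc : F z < c
      · rw [indicator_of_mem hz, indicator_of_mem (s := Kᶜ ∩ {z | F z < c}) ⟨hz, hzc⟩]
      · rw [indicator_of_notMem (s := Kᶜ ∩ {z | F z < c}) fun h => hzc h.2, hT _ (not_lt.1 hzc),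
          zero_smul]
    · rw [indicator_of_notMem hz, indicator_of_notMem (s := Kᶜ ∩ {z | F z < c}) fun h => hz h.1,
        mul_zero, smul_zero]
  have hcont : ContinuousOn (fun z => T (F z) • (Complex.I * v z)) (Kᶜ ∩ {z | F z < c}) :=
    ((hTc.comp_continuousOn hFc).smul (continuousOn_const.mul hv)).mono inter_subset_left
  rw [hindicator, memLp_indicator_iff_restrict hm]
  have hvL : MemLp v 2 (volume.restrict (Kᶜ ∩ {z | F z < c})) :=
    (memLp_two_iff_integrable_sq_norm
      ((hv.mono inter_subset_left).aestronglyMeasurable hm)).2 hen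
  refine hvL.of_le_mul (c := M) (hcont.aestronglyMeasurable hm) (Eventually.of_forall fun z => ?_)
  rw [norm_smul, norm_mul, Complex.norm_I, one_mul]
  exact mul_le_mul_of_nonneg_right (hM _) (norm_nonneg _)

theorem IsFlow.isWeaklyDivFreeOn_I_mul (hK : IsClosed K) (hv : IsFlow K E v) :
    IsWeaklyDivFreeOn (fun z => Complex.I * Kᶜ.indicator v z) Kᶜ volume :=
  (isWeaklyDivFreeOn_conj hK.isOpen_compl
    ((hv.differentiableOn_complexVelocity hK).const_mul (-Complex.I))).congr fun z hz => by
      simp [indicator_of_mem hz, conj_complexVelocity]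

/-- Test the weak form of irrotationality with the function `χ * T ∘ F`. -/
theorem IsStreamFunction.integral_mul_deriv_comp (hK : IsClosed K) (hv : IsFlow K E v)
    (hF : IsStreamFunction K v F) (hc : c < 0) (hT : ∀ y, c ≤ y → T y = 0) (hT₁ : ContDiff ℝ 1 T)
    (hX : LocallyIntegrable fun z => T (F z) • (Complex.I * Kᶜ.indicator v z)) {χ : ℂ → ℝ}
    (hχ : ContDiff ℝ 1 χ) (hχc : HasCompactSupport χ) (hχE : Disjoint (tsupport χ) E) :
    Integrable (fun z => χ z * (deriv T (F z) * ‖Kᶜ.indicator v z‖ ^ 2)) ∧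
      ∫ z, χ z * (deriv T (F z) * ‖Kᶜ.indicator v z‖ ^ 2) =
        -∫ z, fderiv ℝ χ z (T (F z) • (Complex.I * Kᶜ.indicator v z)) := by
  have hsmooth := hF.contDiff_mul_comp hK hv hc hT hT₁ hχ hχE
  have hcompact : HasCompactSupport fun z => χ z * T (F z) := hχc.mul_right
  have hsupport : tsupport (fun z => χ z * T (F z)) ⊆ Kᶜ := fun z hz hzK =>
    notMem_tsupport_iff_eventuallyEq.2 (hF.mul_comp_eventuallyEq_zero hv hc hT hχE hzK) hz
  have hV : LocallyIntegrable fun z => Complex.I * Kᶜ.indicator v z := by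
    exact (locallyIntegrable_of_memLp_two_ball (hv.memLp_indicator_compl hK)).smul Complex.I
  have hφi := integrable_fderiv_apply hV hsmooth hcompact
  have hXi := integrable_fderiv_apply hX hχ hχc
  have hsplit : (fun z => χ z * (deriv T (F z) * ‖Kᶜ.indicator v z‖ ^ 2)) = fun z =>
      fderiv ℝ (fun z => χ z * T (F z)) z (Complex.I * Kᶜ.indicator v z) -
        fderiv ℝ χ z (T (F z) • (Complex.I * Kᶜ.indicator v z)) := by
    ext z
    rw [hF.fderiv_mul_comp_apply (hT₁.differentiable one_ne_zero) (hχ.differentiable one_ne_zero),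
      add_sub_cancel_right]
  rw [hsplit, integral_sub hφi hXi,
    hv.isWeaklyDivFreeOn_I_mul hK _ hsmooth hcompact hsupport, zero_sub]
  exact ⟨hφi.sub hXi, rfl⟩

theorem IsStreamFunction.deriv_comp_mul_norm_sq_eq_zero (hK : IsBody K E) (hv : IsFlow K E v)
    (hF : IsStreamFunction K v F) (hc : c < 0) (hT : ∀ y, c ≤ y → T y = 0) (hT₁ : ContDiff ℝ 1 T)
    (hTanti : Antitone T) (hM : ∀ y, |T y| ≤ M)
    (hen : IntegrableOn (fun z => ‖v z‖ ^ 2) (Kᶜ ∩ {z | F z < c})) :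
    EqOn (fun z => deriv T (F z) * ‖v z‖ ^ 2) 0 Kᶜ := by
  have hclosed : IsClosed K := hK.isCompact.isClosed
  have hvc : ContinuousOn v Kᶜ := hv.differentiableOn.continuousOn
  have hX := hF.memLp_comp_smul hclosed hvc hT hT₁.continuous hM hen
  obtain ⟨χ, hχ⟩ := exists_isCutoffSeq hK.finite_corners
  have htest (n : ℕ) := hF.integral_mul_deriv_comp hclosed hv hc hT hT₁
    (hX.locallyIntegrable one_le_two) (hχ.contDiff n) (hχ.hasCompactSupport n)
    (disjoint_right.2 (hχ.notMem_tsupport n))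
  have hnorm (n : ℕ) (z : ℂ) : ‖χ n z * (deriv T (F z) * ‖Kᶜ.indicator v z‖ ^ 2)‖ =
      -(χ n z * (deriv T (F z) * ‖Kᶜ.indicator v z‖ ^ 2)) :=
    abs_of_nonpos (mul_nonpos_of_nonneg_of_nonpos (hχ.nonneg n z)
      (mul_nonpos_of_nonpos_of_nonneg hTanti.deriv_nonpos (by positivity)))
  have hae : (fun z => deriv T (F z) * ‖Kᶜ.indicator v z‖ ^ 2) =ᵐ[volume] 0 := by
    refine ae_eq_zero_of_tendsto_integral_norm (fun n => (htest n).1) ?_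
      (hχ.ae_tendsto.mono fun z hz => by simpa using hz.mul_const _)
    simp only [hnorm, integral_neg, (htest _).2, neg_neg]
    exact hχ.tendsto_integral_fderiv_apply hX
  refine Measure.eqOn_open_of_ae_eq (μ := volume) ?_ hclosed.isOpen_compl ?_ continuousOn_const
  · refine (ae_restrict_iff' hclosed.measurableSet.compl).2 (hae.mono fun z hz hzK => ?_)
    simpa only [indicator_of_mem hzK] using hz
  · exact ((hT₁.continuous_deriv le_rfl).comp_continuousOn
      (hF.contDiffOn hclosed hvc).continuousOn).mul (hvc.norm.pow 2)

theorem eq_of_expNegInvGlue_eq {x y : ℝ} (hx : 0 < x) (h : expNegInvGlue x = expNegInvGlue y) :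
    x = y := by
  have hy : 0 < y := by
    contrapose! hx
    rwa [← expNegInvGlue.zero_iff_nonpos, h, expNegInvGlue.zero_iff_nonpos]
  simpa [expNegInvGlue, hx.not_ge, hy.not_ge] using h

theorem abs_expNegInvGlue_le_one (x : ℝ) : |expNegInvGlue x| ≤ 1 := by
  rw [abs_of_nonneg (expNegInvGlue.nonneg x), expNegInvGlue]
  split_ifs with hx
  · exact zero_le_one
  · exact Real.exp_le_one_iff.2 (neg_nonpos.2 (inv_nonneg.2 (not_le.1 hx).le))

/-- The energy identity kills the gradient of `expNegInvGlue (c - F)` for a level `c < 0` above a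
negative value of `F`. -/
theorem IsStreamFunction.nonneg_or_eqOn_zero (hK : IsBody K E) (hv : IsFlow K E v)
    (hF : IsStreamFunction K v F)
    (hen : ∀ c < 0, IntegrableOn (fun z => ‖v z‖ ^ 2) (Kᶜ ∩ {z | F z < c})) :
    (∀ z ∈ Kᶜ, 0 ≤ F z) ∨ EqOn v 0 Kᶜ := by
  have hclosed : IsClosed K := hK.isCompact.isClosed
  refine or_iff_not_imp_left.2 fun hneg => ?_
  push Not at hneg
  obtain ⟨z₀, hz₀, hF₀⟩ := hneg
  have hlevel : F z₀ / 2 < 0 := by linarith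
  have hT₁ : ContDiff ℝ 1 fun y => expNegInvGlue (F z₀ / 2 - y) :=
    (expNegInvGlue.contDiff (n := 1)).comp (contDiff_const.sub contDiff_id)
  have henergy := hF.deriv_comp_mul_norm_sq_eq_zero hK hv hlevel
    (fun y hy => expNegInvGlue.zero_of_nonpos (sub_nonpos.2 hy)) hT₁
    (fun x y hxy => expNegInvGlue.monotone (sub_le_sub_left hxy _))
    (fun y => abs_expNegInvGlue_le_one _) (hen _ hlevel)
  have hderiv : ∀ z ∈ Kᶜ,
      HasFDerivAt (fun z => expNegInvGlue (F z₀ / 2 - F z)) (0 : ℂ →L[ℝ] ℝ) z := by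
    intro z hz
    refine ((hT₁.differentiable one_ne_zero (F z)).hasDerivAt.comp_hasFDerivAt z
      (hF.hasFDerivAt z hz)).congr_fderiv ?_
    rcases mul_eq_zero.1 (henergy hz) with h | h
    · rw [h, zero_smul]
    · rw [norm_eq_zero.1 (pow_eq_zero_iff two_ne_zero |>.1 h), map_zero, smul_zero]
  refine hF.eqOn_zero_of_eqOn_const hclosed (c := F z₀) fun z hz => ?_
  have hconst := hclosed.isOpen_compl.is_const_of_fderiv_eq_zero
    hK.isConnected_compl.isPreconnected
    (fun z hz => (hderiv z hz).differentiableAt.differentiableWithinAt)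
    (fun z hz => (hderiv z hz).fderiv) hz₀ hz
  linarith [eq_of_expNegInvGlue_eq (by linarith) hconst]

end Energy

/-! ### Holomorphic functions near infinity -/

section NearInfinity

open Bornology

variable {w : ℂ → ℂ} {a : ℂ} {r R : ℝ}

theorem differentiableAt_comp_inv (hw : ∀ᶠ z in cobounded ℂ, DifferentiableAt ℂ w z) :
    ∀ᶠ ζ in 𝓝[≠] (0 : ℂ), DifferentiableAt ℂ (fun ζ => w ζ⁻¹) ζ := by
  filter_upwards [tendsto_inv₀_nhdsNE_zero.eventually hw, self_mem_nhdsWithin] with ζ hζ hζ₀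
  exact hζ.comp ζ (differentiableAt_inv hζ₀)

theorem exists_tendsto_cobounded_of_isBigO_one
    (hw : ∀ᶠ z in cobounded ℂ, DifferentiableAt ℂ w z)
    (hbdd : w =O[cobounded ℂ] fun _ => (1 : ℝ)) :
    ∃ l, Tendsto w (cobounded ℂ) (𝓝 l) := by
  have hbdd' : (fun ζ => w ζ⁻¹ - w (0 : ℂ)⁻¹) =O[𝓝[≠] 0] fun _ => (1 : ℝ) :=
    (hbdd.comp_tendsto tendsto_inv₀_nhdsNE_zero).sub
      (Asymptotics.isBigO_const_const _ one_ne_zero _)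
  have hlim := Complex.tendsto_limUnder_of_differentiable_on_punctured_nhds_of_bounded_under
    (differentiableAt_comp_inv hw) (Asymptotics.isBigO_one_iff ℝ |>.1 hbdd')
  exact ⟨_, (hlim.comp tendsto_inv₀_cobounded').congr fun z => congrArg w (inv_inv z)⟩

theorem exists_isBigO_sub_div_cobounded
    (hw : ∀ᶠ z in cobounded ℂ, DifferentiableAt ℂ w z)
    (hlim : Tendsto w (cobounded ℂ) (𝓝 0)) :
    ∃ a, (fun z => w z - a / z) =O[cobounded ℂ] fun z => (z ^ 2)⁻¹ := by
  set f : ℂ → ℂ := Function.update (fun ζ => w ζ⁻¹) 0 0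
  have hf_ne (ζ : ℂ) (hζ : ζ ≠ 0) : f ζ = w ζ⁻¹ := Function.update_of_ne hζ _ _
  have hf_analytic : AnalyticAt ℂ f 0 := by
    refine Complex.analyticAt_of_differentiable_on_punctured_nhds_of_continuousAt ?_
      (continuousAt_update_same.2 (hlim.comp tendsto_inv₀_nhdsNE_zero))
    filter_upwards [differentiableAt_comp_inv hw, self_mem_nhdsWithin] with ζ hζ hζ₀
    exact hζ.congr_of_eventuallyEq ((isOpen_ne.eventually_mem hζ₀).mono hf_ne)
  have hslope : DifferentiableAt ℂ (dslope f 0) 0 := by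
    obtain ⟨s, hs, hfs⟩ := hf_analytic.eventually_analyticAt.exists_mem
    exact ((Complex.differentiableOn_dslope hs).2 fun ζ hζ =>
      (hfs ζ hζ).differentiableAt.differentiableWithinAt).differentiableAt hs
  refine ⟨dslope f 0 0, ?_⟩
  have hO := (Asymptotics.isBigO_refl (fun z : ℂ => z⁻¹) (cobounded ℂ)).mul
    (hslope.isBigO_sub.comp_tendsto tendsto_inv₀_cobounded)
  refine hO.congr' ?_ (Eventually.of_forall fun z => ?_)
  · filter_upwards [eventually_ne_cobounded 0] with z hz
    have hfz := sub_smul_dslope f 0 z⁻¹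
    rw [hf_ne _ (inv_ne_zero hz), inv_inv, show f 0 = 0 from Function.update_self _ _ _, sub_zero,
      sub_zero, smul_eq_mul] at hfz
    simp only [Function.comp_apply, mul_sub, hfz, div_eq_inv_mul]
  · simp [sq]

theorem tendsto_mul_cobounded_of_isBigO
    (h : (fun z => w z - a / z) =O[cobounded ℂ] fun z => (z ^ 2)⁻¹) :
    Tendsto (fun z => w z * z) (cobounded ℂ) (𝓝 a) := by
  refine tendsto_sub_nhds_zero_iff.1 <|
    ((h.mul (Asymptotics.isBigO_refl (fun z : ℂ => z) _)).congr' ?_ ?_).trans_tendsto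
      tendsto_inv₀_cobounded
  all_goals
    filter_upwards [eventually_ne_cobounded 0] with z hz
    field_simp

theorem circleIntegral_eq_of_forall_le_norm (hr : 0 < r) (hrR : r ≤ R)
    (hw : ∀ z, r ≤ ‖z‖ → DifferentiableAt ℂ w z) : ∮ z in C(0, R), w z = ∮ z in C(0, r), w z := by
  refine Complex.circleIntegral_eq_of_differentiable_on_annulus_off_countable hr hrR
    countable_empty (fun z hz => (hw z ?_).continuousAt.continuousWithinAt) fun z hz => hw z ?_
  · simpa using hz.2
  · simpa using (not_le.1 (mem_closedBall_zero_iff.not.1 hz.1.2)).le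

theorem tendsto_circleIntegral_of_isBigO
    (h : w =O[cobounded ℂ] fun z => (z ^ 2)⁻¹) :
    Tendsto (fun R => ∮ z in C(0, R), w z) atTop (𝓝 0) := by
  obtain ⟨C, hC⟩ := h.bound
  rw [← comap_norm_atTop, eventually_comap] at hC
  have hlim : Tendsto (fun R : ℝ => 2 * Real.pi * C * R⁻¹) atTop (𝓝 0) := by
    simpa using tendsto_inv_atTop_zero.const_mul (2 * Real.pi * C)
  refine squeeze_zero_norm' ?_ hlim
  filter_upwards [hC, eventually_gt_atTop 0] with R hR hR₀
  refine (circleIntegral.norm_integral_le_of_norm_le_const hR₀.le (C := C * (R ^ 2)⁻¹)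
    fun z hz => ?_).trans_eq (by field_simp)
  have hz_norm : ‖z‖ = R := mem_sphere_zero_iff_norm.1 hz
  simpa [hz_norm] using hR z hz_norm

theorem circleIntegral_eq_two_pi_I_mul_of_isBigO (hr : 0 < r)
    (hw : ∀ z, r ≤ ‖z‖ → DifferentiableAt ℂ w z)
    (h : (fun z => w z - a / z) =O[cobounded ℂ] fun z => (z ^ 2)⁻¹) :
    ∮ z in C(0, r), w z = 2 * Real.pi * Complex.I * a := by
  refine sub_eq_zero.1 (tendsto_nhds_unique (tendsto_const_nhds.congr' ?_)
    (tendsto_circleIntegral_of_isBigO h))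
  filter_upwards [eventually_ge_atTop r] with R hR
  have hR₀ : 0 < R := hr.trans_le hR
  have hne : ∀ z ∈ Metric.sphere (0 : ℂ) R, z ≠ 0 := fun z hz =>
    ne_zero_of_mem_sphere hR₀.ne' ⟨z, hz⟩
  rw [circleIntegral.integral_sub, circleIntegral_eq_of_forall_le_norm hr hR hw]
  · have hinv := circleIntegral.integral_sub_center_inv (0 : ℂ) hR₀.ne'
    simp only [sub_zero] at hinv
    simp only [div_eq_mul_inv, circleIntegral.integral_const_mul, hinv, mul_comm]
  · refine ContinuousOn.circleIntegrable hR₀.le fun z hz =>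
      (hw z ?_).continuousAt.continuousWithinAt
    rwa [mem_sphere_zero_iff_norm.1 hz]
  · exact (continuousOn_const.div continuousOn_id hne).circleIntegrable hR₀.le

theorem mul_le_sub_of_le_fderiv_apply_self {V : Type*} [NormedAddCommGroup V] [NormedSpace ℝ V]
    {F : V → ℝ} {F' : V → V →L[ℝ] ℝ} {b s : ℝ} {u : V}
    (hF : ∀ t : ℝ, 1 ≤ t → HasFDerivAt F (F' (t • u)) (t • u))
    (hb : ∀ t : ℝ, 1 ≤ t → b ≤ F' (t • u) (t • u)) (hs : 0 ≤ s) :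
    b * s ≤ F (Real.exp s • u) - F u := by
  have hd (x : ℝ) (hx : x ∈ Ici (0 : ℝ)) :
      HasDerivAt (fun x => F (Real.exp x • u)) (F' (Real.exp x • u) (Real.exp x • u)) x :=
    (hF _ (Real.one_le_exp hx)).comp_hasDerivAt x ((Real.hasDerivAt_exp x).smul_const u)
  have hmvt := (convex_Ici (0 : ℝ)).mul_sub_le_image_sub_of_le_deriv (C := b)
    (fun x hx => (hd x hx).continuousAt.continuousWithinAt)
    (fun x hx => (hd x (interior_subset hx)).differentiableAt.differentiableWithinAt)
    (fun x hx => by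
      rw [(hd x (interior_subset hx)).deriv]
      exact hb _ (Real.one_le_exp (interior_subset hx)))
    0 self_mem_Ici s hs hs
  simpa using hmvt

theorem tendsto_atTop_cobounded_of_le_fderiv_apply_self {V : Type*} [NormedAddCommGroup V]
    [NormedSpace ℝ V] [ProperSpace V] {F : V → ℝ} {F' : V → V →L[ℝ] ℝ} {b : ℝ} (hb : 0 < b)
    (hF : ∀ᶠ z in cobounded V, HasFDerivAt F (F' z) z) (hF' : ∀ᶠ z in cobounded V, b ≤ F' z z) :
    Tendsto F (cobounded V) atTop := by
  obtain ⟨r, -, hr⟩ := hasBasis_cobounded_norm.eventually_iff.1 (hF.and hF')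
  obtain ⟨ρ, hρ₀, hρ⟩ : ∃ ρ > 0, ∀ z, ρ ≤ ‖z‖ → HasFDerivAt F (F' z) z ∧ b ≤ F' z z :=
    ⟨max r 1, by positivity, fun z hz => hr (le_of_max_le_left hz)⟩
  obtain ⟨m, hm⟩ := (isCompact_sphere (0 : V) ρ).bddBelow_image fun z hz =>
    (hρ z (mem_sphere_zero_iff_norm.1 hz).ge).1.continuousAt.continuousWithinAt
  have hlog (z : V) (hz : ρ ≤ ‖z‖) : m + b * Real.log (‖z‖ / ρ) ≤ F z := by
    have hz₀ : 0 < ‖z‖ := hρ₀.trans_le hz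
    set u : V := (ρ / ‖z‖) • z
    have hu : ‖u‖ = ρ := by simp [u, norm_smul, abs_of_pos hρ₀, hz₀.ne']
    have hexp : Real.exp (Real.log (‖z‖ / ρ)) • u = z := by
      rw [Real.exp_log (by positivity), smul_smul, div_mul_div_cancel₀ hρ₀.ne', div_self hz₀.ne',
        one_smul]
    have hray (t : ℝ) (ht : 1 ≤ t) : ρ ≤ ‖t • u‖ := by
      rw [norm_smul, hu, Real.norm_of_nonneg (by positivity)]
      exact le_mul_of_one_le_left hρ₀.le ht
    have hgrowth := mul_le_sub_of_le_fderiv_apply_self (fun t ht => (hρ _ (hray t ht)).1)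
      (fun t ht => (hρ _ (hray t ht)).2) (Real.log_nonneg ((one_le_div hρ₀).2 hz))
    rw [hexp] at hgrowth
    linarith [hm ⟨u, mem_sphere_zero_iff_norm.2 hu, rfl⟩]
  refine tendsto_atTop_mono' _ ((eventually_cobounded_le_norm ρ).mono hlog) ?_
  exact tendsto_atTop_add_const_left _ _ <| (Real.tendsto_log_atTop.comp
    (tendsto_norm_cobounded_atTop.atTop_div_const hρ₀)).const_mul_atTop hb

end NearInfinity

section FlowAlgebra

variable {K E : Set ℂ} {v v₁ v₂ : ℂ → ℂ} {p wInf : ℂ}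

theorem planeDiv_sub {z : ℂ} (h₁ : DifferentiableAt ℝ v₁ z) (h₂ : DifferentiableAt ℝ v₂ z) :
    planeDiv (v₁ - v₂) z = planeDiv v₁ z - planeDiv v₂ z := by
  simp only [planeDiv, fderiv_sub h₁ h₂, sub_apply, Complex.sub_re, Complex.sub_im]
  ring

theorem planeCurl_sub {z : ℂ} (h₁ : DifferentiableAt ℝ v₁ z) (h₂ : DifferentiableAt ℝ v₂ z) :
    planeCurl (v₁ - v₂) z = planeCurl v₁ z - planeCurl v₂ z := by
  simp only [planeCurl, fderiv_sub h₁ h₂, sub_apply, Complex.sub_re, Complex.sub_im]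
  ring

theorem complexVelocity_sub (v₁ v₂ : ℂ → ℂ) :
    complexVelocity (v₁ - v₂) = complexVelocity v₁ - complexVelocity v₂ :=
  funext fun z => map_sub (starRingEnd ℂ) (v₁ z) (v₂ z)

theorem norm_complexVelocity (v : ℂ → ℂ) (z : ℂ) : ‖complexVelocity v z‖ = ‖v z‖ :=
  RCLike.norm_conj (v z)

theorem continuousOn_complexVelocity {s : Set ℂ} (hv : ContinuousOn v s) :
    ContinuousOn (complexVelocity v) s :=
  Complex.continuous_conj.comp_continuousOn hv

theorem VelocityBoundedNear.sub (h₁ : VelocityBoundedNear K v₁ p)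
    (h₂ : VelocityBoundedNear K v₂ p) : VelocityBoundedNear K (v₁ - v₂) p := by
  obtain ⟨r₁, hr₁, C₁, hC₁⟩ := h₁
  obtain ⟨r₂, hr₂, C₂, hC₂⟩ := h₂
  refine ⟨min r₁ r₂, lt_min hr₁ hr₂, C₁ + C₂, fun z hz hd => ?_⟩
  exact norm_sub_le_of_le (hC₁ z hz (hd.trans_le (min_le_left _ _)))
    (hC₂ z hz (hd.trans_le (min_le_right _ _)))

theorem HasVelocityAtInfinity.sub (h₁ : HasVelocityAtInfinity v₁ wInf)
    (h₂ : HasVelocityAtInfinity v₂ wInf) : HasVelocityAtInfinity (v₁ - v₂) 0 := by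
  rw [HasVelocityAtInfinity, complexVelocity_sub, ← sub_self wInf]
  exact Tendsto.sub h₁ h₂

theorem isFlow_zero (K E : Set ℂ) : IsFlow K E 0 where
  differentiableOn := differentiableOn_const 0
  incompressible z _ := by simp [planeDiv]
  irrotational z _ := by simp [planeCurl]
  slip p _ u g r _ := by simpa using tendsto_const_nhds
  bounded_at_infinity := ⟨0, 0, fun z _ _ => by simp⟩
  bounded_near_regular p _ := ⟨1, one_pos, 0, fun z _ _ => by simp⟩
  square_integrable R := by simp

theorem IsFlow.sub (hK : IsClosed K) (h₁ : IsFlow K E v₁) (h₂ : IsFlow K E v₂) :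
    IsFlow K E (v₁ - v₂) where
  differentiableOn := h₁.differentiableOn.sub h₂.differentiableOn
  incompressible z hz := by
    have hΩ := hK.isOpen_compl.mem_nhds hz
    rw [planeDiv_sub (h₁.differentiableOn.differentiableAt hΩ)
      (h₂.differentiableOn.differentiableAt hΩ), h₁.incompressible z hz, h₂.incompressible z hz,
      sub_zero]
  irrotational z hz := by
    have hΩ := hK.isOpen_compl.mem_nhds hz
    rw [planeCurl_sub (h₁.differentiableOn.differentiableAt hΩ)
      (h₂.differentiableOn.differentiableAt hΩ), h₁.irrotational z hz, h₂.irrotational z hz,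
      sub_zero]
  slip p hp u g r hc := by
    simpa only [Pi.sub_apply, inner_sub_right, sub_zero]
      using (h₁.slip p hp u g r hc).sub (h₂.slip p hp u g r hc)
  bounded_at_infinity := by
    obtain ⟨R₁, C₁, hC₁⟩ := h₁.bounded_at_infinity
    obtain ⟨R₂, C₂, hC₂⟩ := h₂.bounded_at_infinity
    exact ⟨max R₁ R₂, C₁ + C₂, fun z hz hR => norm_sub_le_of_le
      (hC₁ z hz ((le_max_left _ _).trans_lt hR)) (hC₂ z hz ((le_max_right _ _).trans_lt hR))⟩
  bounded_near_regular p hp := (h₁.bounded_near_regular p hp).sub (h₂.bounded_near_regular p hp)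
  square_integrable R := by
    have hm : MeasurableSet Kᶜ := hK.isOpen_compl.measurableSet
    have hL := (h₁.memLp_indicator_compl hK R).sub (h₂.memLp_indicator_compl hK R)
    rw [← indicator_sub', memLp_indicator_iff_restrict hm, Measure.restrict_restrict hm] at hL
    exact (memLp_two_iff_integrable_sq_norm hL.aestronglyMeasurable).1 hL

theorem IsFlow.neg (hK : IsClosed K) (hv : IsFlow K E v) : IsFlow K E (-v) := by
  simpa only [zero_sub] using (isFlow_zero K E).sub hK hv

end FlowAlgebra

/-! ### Circulation and far field -/

section FarField

open Bornology

variable {K E : Set ℂ} {v v₁ v₂ : ℂ → ℂ} {F : ℂ → ℝ} {R Γ Γ₁ Γ₂ : ℝ}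

theorem mem_compl_of_le_norm (hR : K ⊆ Metric.ball 0 R) {z : ℂ} (hz : R ≤ ‖z‖) : z ∈ Kᶜ :=
  fun hzK => (mem_ball_zero_iff.1 (hR hzK)).not_ge hz

theorem circleMap_mem_compl (hR : K ⊆ Metric.ball 0 R) (θ : ℝ) : circleMap 0 R θ ∈ Kᶜ :=
  mem_compl_of_le_norm hR (by simpa using le_abs_self R)

theorem pos_of_subset_ball (hne : K.Nonempty) (hR : K ⊆ Metric.ball 0 R) : 0 < R :=
  Metric.nonempty_ball.1 (hne.mono hR)

theorem circleIntegrable_complexVelocity (hv : ContinuousOn v Kᶜ) (hR : K ⊆ Metric.ball 0 R) :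
    CircleIntegrable (complexVelocity v) 0 R :=
  ContinuousOn.circleIntegrable' <| (continuousOn_complexVelocity hv).mono fun _ hz =>
    mem_compl_of_le_norm hR ((le_abs_self R).trans_eq (mem_sphere_zero_iff_norm.1 hz).symm)

theorem integral_inner_circleMap (hw : CircleIntegrable (complexVelocity v) 0 R) :
    ∫ θ in (0 : ℝ)..(2 * Real.pi), inner ℝ (v (circleMap 0 R θ)) (deriv (circleMap 0 R) θ) =
      (∮ z in C(0, R), complexVelocity v z).re := by
  rw [circleIntegral, ← Complex.reCLM_apply,
    ← ContinuousLinearMap.intervalIntegral_comp_comm _ hw.out]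
  refine intervalIntegral.integral_congr fun θ _ => ?_
  simp [Complex.inner, complexVelocity]

theorem HasCirculation.re_circleIntegral (hΓ : HasCirculation K v Γ) (hv : ContinuousOn v Kᶜ)
    (hR : K ⊆ Metric.ball 0 R) : (∮ z in C(0, R), complexVelocity v z).re = Γ :=
  (integral_inner_circleMap (circleIntegrable_complexVelocity hv hR)).symm.trans (hΓ R hR)

theorem HasCirculation.sub (hv₁ : ContinuousOn v₁ Kᶜ) (hv₂ : ContinuousOn v₂ Kᶜ)
    (h₁ : HasCirculation K v₁ Γ₁) (h₂ : HasCirculation K v₂ Γ₂) :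
    HasCirculation K (v₁ - v₂) (Γ₁ - Γ₂) := by
  intro R hR
  rw [integral_inner_circleMap (circleIntegrable_complexVelocity (hv₁.sub hv₂) hR),
    complexVelocity_sub]
  simp only [Pi.sub_apply]
  rw [circleIntegral.integral_sub (circleIntegrable_complexVelocity hv₁ hR)
    (circleIntegrable_complexVelocity hv₂ hR), Complex.sub_re, h₁.re_circleIntegral hv₁ hR,
    h₂.re_circleIntegral hv₂ hR]

theorem HasCirculation.eq_of_eqOn (hK : IsBounded K) (h : EqOn v₁ v₂ Kᶜ)
    (h₁ : HasCirculation K v₁ Γ₁) (h₂ : HasCirculation K v₂ Γ₂) : Γ₁ = Γ₂ := by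
  obtain ⟨R, hR⟩ := hK.subset_ball (0 : ℂ)
  rw [← h₁ R hR, ← h₂ R hR]
  exact intervalIntegral.integral_congr fun θ _ => by simp only [h (circleMap_mem_compl hR θ)]

theorem IsFlow.differentiableAt_complexVelocity (hK : IsClosed K) (hv : IsFlow K E v)
    (hR : K ⊆ Metric.ball 0 R) {z : ℂ} (hz : R ≤ ‖z‖) :
    DifferentiableAt ℂ (complexVelocity v) z :=
  (hv.differentiableOn_complexVelocity hK).differentiableAt
    (hK.isOpen_compl.mem_nhds (mem_compl_of_le_norm hR hz))

theorem IsFlow.eventually_differentiableAt_complexVelocity (hK : IsCompact K)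
    (hv : IsFlow K E v) : ∀ᶠ z in cobounded ℂ, DifferentiableAt ℂ (complexVelocity v) z := by
  obtain ⟨R, hR⟩ := hK.isBounded.subset_ball (0 : ℂ)
  filter_upwards [eventually_cobounded_le_norm R] with z hz
  exact hv.differentiableAt_complexVelocity hK.isClosed hR hz

theorem IsFlow.exists_hasVelocityAtInfinity (hK : IsCompact K) (hv : IsFlow K E v) :
    ∃ wInf, HasVelocityAtInfinity v wInf := by
  obtain ⟨R, C, hC⟩ := hv.bounded_at_infinity
  refine exists_tendsto_cobounded_of_isBigO_one
    (hv.eventually_differentiableAt_complexVelocity hK) (.of_bound C ?_)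
  filter_upwards [isBounded_def.1 hK.isBounded,
    tendsto_norm_cobounded_atTop.eventually_gt_atTop R] with z hz hzR
  simpa [norm_complexVelocity] using hC z hz hzR

theorem IsFlow.exists_hasCirculation (hK : IsCompact K) (hne : K.Nonempty) (hv : IsFlow K E v) :
    ∃ Γ, HasCirculation K v Γ := by
  obtain ⟨R₀, hR₀⟩ := hK.isBounded.subset_ball (0 : ℂ)
  refine ⟨(∮ z in C(0, R₀), complexVelocity v z).re, fun R hR => ?_⟩
  rw [integral_inner_circleMap
    (circleIntegrable_complexVelocity hv.differentiableOn.continuousOn hR)]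
  congr 1
  rcases le_total R R₀ with h | h
  · exact (circleIntegral_eq_of_forall_le_norm (pos_of_subset_ball hne hR) h fun z =>
      hv.differentiableAt_complexVelocity hK.isClosed hR).symm
  · exact circleIntegral_eq_of_forall_le_norm (pos_of_subset_ball hne hR₀) h fun z =>
      hv.differentiableAt_complexVelocity hK.isClosed hR₀

theorem IsStreamFunction.im_circleIntegral_eq_zero (hF : IsStreamFunction K v F)
    (hv : ContinuousOn v Kᶜ) (hR : K ⊆ Metric.ball 0 R) :
    (∮ z in C(0, R), complexVelocity v z).im = 0 := by
  have hw := circleIntegrable_complexVelocity hv hR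
  rw [circleIntegral, ← Complex.imCLM_apply,
    ← ContinuousLinearMap.intervalIntegral_comp_comm _ hw.out]
  have hd (θ : ℝ) : HasDerivAt (fun θ => F (circleMap 0 R θ))
      (Complex.imCLM (deriv (circleMap 0 R) θ • complexVelocity v (circleMap 0 R θ))) θ := by
    refine ((hF.hasFDerivAt _ (circleMap_mem_compl hR θ)).comp_hasDerivAt θ
      (hasDerivAt_circleMap 0 R θ)).congr_deriv ?_
    rw [fluxForm_apply, deriv_circleMap, Complex.imCLM_apply, smul_eq_mul, mul_comm]
    rfl
  rw [intervalIntegral.integral_eq_sub_of_hasDerivAt (fun θ _ => hd θ)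
    ⟨Complex.imCLM.integrable_comp hw.out.1, Complex.imCLM.integrable_comp hw.out.2⟩]
  simpa [sub_eq_zero] using congrArg F (periodic_circleMap 0 R 0)

theorem IsFlow.circleIntegral_complexVelocity (hK : IsBody K E) (hv : IsFlow K E v)
    (hΓ : HasCirculation K v Γ) (hR : K ⊆ Metric.ball 0 R) :
    ∮ z in C(0, R), complexVelocity v z = Γ := by
  obtain ⟨F, hF⟩ := hv.exists_isStreamFunction hK
  have hcont := hv.differentiableOn.continuousOn
  exact Complex.ext (hΓ.re_circleIntegral hcont hR) (hF.im_circleIntegral_eq_zero hcont hR)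

theorem IsFlow.isBigO_complexVelocity_sub (hK : IsBody K E) (hv : IsFlow K E v)
    (hinf : HasVelocityAtInfinity v 0) (hΓ : HasCirculation K v Γ) :
    (fun z => complexVelocity v z - Γ / (2 * Real.pi * Complex.I) / z) =O[cobounded ℂ]
      fun z => (z ^ 2)⁻¹ := by
  obtain ⟨a, ha⟩ := exists_isBigO_sub_div_cobounded
    (hv.eventually_differentiableAt_complexVelocity hK.isCompact) hinf
  obtain ⟨R, hR⟩ := hK.isCompact.isBounded.subset_ball (0 : ℂ)
  have hne : K.Nonempty := hK.isConnected_interior.nonempty.mono interior_subset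
  have hint := circleIntegral_eq_two_pi_I_mul_of_isBigO (pos_of_subset_ball hne hR)
    (fun z => hv.differentiableAt_complexVelocity hK.isCompact.isClosed hR) ha
  rwa [← hv.circleIntegral_complexVelocity hK hΓ hR, hint, mul_div_cancel_left₀]
  exact Complex.two_pi_I_ne_zero

end FarField

section FiniteEnergy

open Bornology

variable {K E : Set ℂ} {v : ℂ → ℂ} {F : ℂ → ℝ} {Γ : ℝ}

theorem isBigO_norm_sq_of_isBigO_inv_sq {V : Type*} [NormedAddCommGroup V]
    {f : ℂ → V} (hf : f =O[cobounded ℂ] fun z => (z ^ 2)⁻¹) :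
    (fun z => ‖f z‖ ^ 2) =O[cobounded ℂ] fun z => (1 + ‖z‖) ^ (-4 : ℝ) := by
  refine (hf.norm_left.pow 2).trans (.of_bound 16 ?_)
  filter_upwards [eventually_cobounded_le_norm (1 : ℝ)] with z hz
  have hpow : (1 + ‖z‖) ^ 4 ≤ (2 * ‖z‖) ^ 4 := pow_le_pow_left₀ (by positivity) (by linarith) 4
  rw [Real.norm_of_nonneg (by positivity), Real.rpow_neg (by positivity), norm_pow, norm_inv,
    norm_pow, ← div_eq_mul_inv, le_div_iff₀ (by positivity), inv_pow,
    inv_mul_le_iff₀ (by positivity)]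
  calc (1 + ‖z‖) ^ (4 : ℝ) = (1 + ‖z‖) ^ 4 := mod_cast Real.rpow_natCast _ 4
    _ ≤ (2 * ‖z‖) ^ 4 := hpow
    _ = (‖z‖ ^ 2) ^ 2 * 16 := by ring

theorem IsFlow.locallyIntegrable_indicator_norm_sq (hK : IsClosed K) (hv : IsFlow K E v) :
    LocallyIntegrable (Kᶜ.indicator fun z => ‖v z‖ ^ 2) := by
  refine fun z => ⟨Metric.ball 0 (‖z‖ + 1), Metric.isOpen_ball.mem_nhds (by simp), ?_⟩
  rw [integrableOn_indicator_iff hK.isOpen_compl.measurableSet]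
  exact hv.square_integrable _

theorem IsFlow.integrableOn_norm_sq_of_isBigO (hK : IsClosed K) (hv : IsFlow K E v)
    (hO : v =O[cobounded ℂ] fun z => (z ^ 2)⁻¹) : IntegrableOn (fun z => ‖v z‖ ^ 2) Kᶜ := by
  rw [← integrable_indicator_iff hK.isOpen_compl.measurableSet]
  refine (hv.locallyIntegrable_indicator_norm_sq hK).integrable_of_isBigO_cocompact
    (g := fun z => (1 + ‖z‖) ^ (-4 : ℝ)) ?_ ?_
  · rw [← Metric.cobounded_eq_cocompact]
    refine (Asymptotics.isBigO_of_le _ fun z => ?_).trans (isBigO_norm_sq_of_isBigO_inv_sq hO)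
    exact norm_indicator_le_norm_self _ _
  · exact (integrable_one_add_norm
      (by norm_num [Complex.finrank_real_complex])).integrableAtFilter _

theorem IsFlow.eqOn_zero_of_integrableOn (hK : IsBody K E) (hv : IsFlow K E v)
    (hen : IntegrableOn (fun z => ‖v z‖ ^ 2) Kᶜ) : EqOn v 0 Kᶜ := by
  have hclosed := hK.isCompact.isClosed
  obtain ⟨F, hF⟩ := hv.exists_isStreamFunction hK
  rcases hF.nonneg_or_eqOn_zero hK hv fun c _ => hen.mono_set inter_subset_left with hnn | hv₀
  · rcases hF.neg.nonneg_or_eqOn_zero hK (hv.neg hclosed) fun c _ =>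
      IntegrableOn.mono_set (by simpa using hen) inter_subset_left with hnp | hv₀
    · exact hF.eqOn_zero_of_eqOn_const hclosed (c := 0) fun z hz =>
        le_antisymm (neg_nonneg.1 (hnp z hz)) (hnn z hz)
    · exact fun z hz => neg_eq_zero.1 (hv₀ hz)
  · exact hv₀

theorem IsFlow.eqOn_zero_of_hasCirculation_zero (hK : IsBody K E) (hv : IsFlow K E v)
    (hinf : HasVelocityAtInfinity v 0) (hΓ : HasCirculation K v 0) : EqOn v 0 Kᶜ := by
  refine hv.eqOn_zero_of_integrableOn hK
    (hv.integrableOn_norm_sq_of_isBigO hK.isCompact.isClosed ?_)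
  have hO := hv.isBigO_complexVelocity_sub hK hinf hΓ
  simp only [Complex.ofReal_zero, zero_div, sub_zero] at hO
  exact hO.norm_left.congr_left (norm_complexVelocity v) |>.of_norm_left

theorem IsStreamFunction.tendsto_cobounded_atTop (hK : IsBody K E) (hv : IsFlow K E v)
    (hF : IsStreamFunction K v F) (hinf : HasVelocityAtInfinity v 0) (hΓ : HasCirculation K v Γ)
    (hneg : Γ < 0) : Tendsto F (cobounded ℂ) atTop := by
  have hlim : Tendsto (fun z => fluxForm (v z) z) (cobounded ℂ) (𝓝 (-Γ / (2 * Real.pi))) := by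
    have him : (Γ / (2 * Real.pi * Complex.I)).im = -Γ / (2 * Real.pi) := by
      rw [← div_div, Complex.div_I, ← Complex.ofReal_ofNat, ← Complex.ofReal_mul,
        ← Complex.ofReal_div, Complex.neg_im, Complex.im_ofReal_mul, Complex.I_im, mul_one, neg_div]
    simp only [fluxForm_apply]
    exact him ▸ (Complex.continuous_im.tendsto _).comp
      (tendsto_mul_cobounded_of_isBigO (hv.isBigO_complexVelocity_sub hK hinf hΓ))
  have hb : 0 < -Γ / (2 * Real.pi) := div_pos (neg_pos.2 hneg) Real.two_pi_pos
  exact tendsto_atTop_cobounded_of_le_fderiv_apply_self (half_pos hb)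
    (mem_of_superset (isBounded_def.1 hK.isCompact.isBounded) hF.hasFDerivAt)
    (hlim.eventually_const_le (half_lt_self hb))

theorem IsStreamFunction.nonneg_or_eqOn_zero_of_tendsto_atTop (hK : IsBody K E) (hv : IsFlow K E v)
    (hF : IsStreamFunction K v F) (hlim : Tendsto F (cobounded ℂ) atTop) :
    (∀ z ∈ Kᶜ, 0 ≤ F z) ∨ EqOn v 0 Kᶜ := by
  refine hF.nonneg_or_eqOn_zero hK hv fun c _ => ?_
  obtain ⟨R, -, hR⟩ := hasBasis_cobounded_norm.eventually_iff.1 (hlim.eventually_ge_atTop c)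
  refine (hv.square_integrable R).mono_set (inter_subset_inter_right _ fun z hz => ?_)
  exact mem_ball_zero_iff.2 (not_le.1 fun hzR => (hR hzR).not_gt hz)

end FiniteEnergy

/-! ### Harnack's inequality -/

section Harnack

variable {f : ℂ → ℂ} {a b c z : ℂ} {R s : ℝ}

theorem norm_sub_lt_norm_sub_conj (ha : 0 < a.im) (hb : 0 < b.im) :
    ‖a - b‖ < ‖a - starRingEnd ℂ b‖ := by
  refine lt_of_pow_lt_pow_left₀ 2 (norm_nonneg _) ?_
  simp only [Complex.sq_norm, Complex.normSq_apply, Complex.sub_re, Complex.sub_im,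
    Complex.conj_re, Complex.conj_im]
  linarith [mul_pos ha hb]

theorem abs_im_sub_im_le_of_norm_sub_le (hs₀ : 0 ≤ s) (hs₁ : s ≤ 1) (hab : 0 ≤ a.im + b.im)
    (h : ‖a - b‖ ≤ s * ‖a - starRingEnd ℂ b‖) : |a.im - b.im| ≤ s * (a.im + b.im) := by
  refine abs_le_of_sq_le_sq ?_ (mul_nonneg hs₀ hab)
  have hsq := pow_le_pow_left₀ (norm_nonneg _) h 2
  simp only [mul_pow, Complex.sq_norm, Complex.normSq_apply, Complex.sub_re, Complex.sub_im,
    Complex.conj_re, Complex.conj_im] at hsq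
  nlinarith [mul_nonneg (sub_nonneg.2 (pow_le_one₀ (n := 2) hs₀ hs₁)) (sq_nonneg (a.re - b.re))]

/-- The Schwarz lemma for `f` followed by the Cayley transform sending `f c` to `0`. -/
theorem norm_sub_le_mul_norm_sub_conj_of_im_pos (hf : DifferentiableOn ℂ f (Metric.ball c R))
    (him : ∀ y ∈ Metric.ball c R, 0 < (f y).im) (hz : z ∈ Metric.ball c R) :
    ‖f z - f c‖ ≤ dist z c / R * ‖f z - starRingEnd ℂ (f c)‖ := by
  have hlt (y : ℂ) (hy : y ∈ Metric.ball c R) : ‖f y - f c‖ < ‖f y - starRingEnd ℂ (f c)‖ :=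
    norm_sub_lt_norm_sub_conj (him y hy)
      (him c (Metric.mem_ball_self (Metric.pos_of_mem_ball hz)))
  have hpos (y : ℂ) (hy : y ∈ Metric.ball c R) : 0 < ‖f y - starRingEnd ℂ (f c)‖ :=
    (norm_nonneg _).trans_lt (hlt y hy)
  have hcayley : DifferentiableOn ℂ (fun y => (f y - f c) / (f y - starRingEnd ℂ (f c)))
      (Metric.ball c R) :=
    (hf.sub_const _).div (hf.sub_const _) fun y hy => norm_pos_iff.1 (hpos y hy)
  have hschwarz := Complex.dist_le_div_mul_dist_of_mapsTo_ball hcayley (R₂ := 1)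
    (fun y hy => by
      rw [sub_self, zero_div, mem_closedBall_zero_iff, norm_div]
      exact div_le_one_of_le₀ (hlt y hy).le (norm_nonneg _)) hz
  rwa [sub_self, zero_div, dist_zero_right, norm_div, div_le_iff₀ (hpos z hz),
    one_div_mul_eq_div] at hschwarz

theorem abs_im_sub_im_le_of_im_nonneg (hf : DifferentiableOn ℂ f (Metric.ball c R))
    (him : ∀ y ∈ Metric.ball c R, 0 ≤ (f y).im) (hz : z ∈ Metric.ball c R) :
    |(f z).im - (f c).im| ≤ dist z c / R * ((f z).im + (f c).im) := by
  have hR : 0 < R := Metric.pos_of_mem_ball hz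
  have hshift (δ : ℝ) (hδ : 0 < δ) :
      |(f z).im - (f c).im| ≤ dist z c / R * ((f z).im + (f c).im + 2 * δ) := by
    have him' (y : ℂ) (hy : y ∈ Metric.ball c R) : 0 < (f y + δ * Complex.I).im := by
      simpa using add_pos_of_nonneg_of_pos (him y hy) hδ
    have habs := abs_im_sub_im_le_of_norm_sub_le (by positivity)
      ((div_le_one hR).2 (Metric.mem_ball.1 hz).le)
      (add_pos (him' z hz) (him' c (Metric.mem_ball_self hR))).le
      (norm_sub_le_mul_norm_sub_conj_of_im_pos (hf.add_const _) him' hz)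
    simp only [Complex.add_im, Complex.im_ofReal_mul, Complex.I_im, mul_one,
      add_sub_add_right_eq_sub] at habs
    exact habs.trans_eq (by ring)
  refine ge_of_tendsto (b := |(f z).im - (f c).im|) (f := fun δ : ℝ =>
    dist z c / R * ((f z).im + (f c).im + 2 * δ)) (x := 𝓝[>] 0) ?_
    (eventually_mem_nhdsWithin.mono hshift)
  exact ((Continuous.tendsto' (by fun_prop) 0 _ (by simp)).mono_left nhdsWithin_le_nhds)

end Harnack

section PositiveStreamFunction

variable {K : Set ℂ} {v u ψ : ℂ → ℂ} {F G : ℂ → ℝ} {c z : ℂ} {R : ℝ}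

theorem exists_im_eq_of_hasFDerivAt_fluxForm
    (hG : ∀ y ∈ Metric.ball c R, HasFDerivAt G (fluxForm (u y)) y)
    (hu : DifferentiableOn ℂ (complexVelocity u) (Metric.ball c R)) :
    ∃ f : ℂ → ℂ, DifferentiableOn ℂ f (Metric.ball c R) ∧
      ∀ y ∈ Metric.ball c R, (f y).im = G y := by
  obtain ⟨f, hfc, hf⟩ := hu.isExactOn_ball.with_val_at c (G c * Complex.I)
  refine ⟨f, fun y hy => (hf y hy).differentiableAt.differentiableWithinAt, fun y hy => ?_⟩
  have hd (y : ℂ) (hy : y ∈ Metric.ball c R) :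
      HasFDerivAt (fun y => (f y).im - G y) (0 : ℂ →L[ℝ] ℝ) y := by
    refine ((Complex.imCLM.hasFDerivAt.comp y (hf y hy).complexToReal_fderiv).sub
      (hG y hy)).congr_fderiv (ContinuousLinearMap.ext fun h => ?_)
    simp [fluxForm_apply, complexVelocity]
  have hconst := Metric.isOpen_ball.is_const_of_fderiv_eq_zero (𝕜 := ℝ)
    (convex_ball c R).isPreconnected
    (fun y hy => (hd y hy).differentiableAt.differentiableWithinAt)
    (fun y hy => (hd y hy).fderiv) hy (Metric.mem_ball_self (Metric.pos_of_mem_ball hy))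
  simpa [hfc, sub_eq_zero] using hconst

theorem abs_sub_le_of_hasFDerivAt_fluxForm
    (hG : ∀ y ∈ Metric.ball c R, HasFDerivAt G (fluxForm (u y)) y)
    (hu : DifferentiableOn ℂ (complexVelocity u) (Metric.ball c R))
    (hnn : ∀ y ∈ Metric.ball c R, 0 ≤ G y) (hz : z ∈ Metric.ball c R) :
    |G z - G c| ≤ dist z c / R * (G z + G c) := by
  obtain ⟨f, hf, him⟩ := exists_im_eq_of_hasFDerivAt_fluxForm hG hu
  rw [← him z hz, ← him c (Metric.mem_ball_self (Metric.pos_of_mem_ball hz))]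
  exact abs_im_sub_im_le_of_im_nonneg hf (fun y hy => (him y hy).symm ▸ hnn y hy) hz

theorem IsStreamFunction.abs_comp_sub_le (hF : IsStreamFunction K v F)
    (hw : DifferentiableOn ℂ (complexVelocity v) Kᶜ) (hnn : ∀ z ∈ Kᶜ, 0 ≤ F z)
    (hψ : DifferentiableOn ℂ ψ (Metric.ball c R)) (hmaps : MapsTo ψ (Metric.ball c R) Kᶜ)
    (hz : z ∈ Metric.ball c R) :
    |F (ψ z) - F (ψ c)| ≤ dist z c / R * (F (ψ z) + F (ψ c)) := by
  refine abs_sub_le_of_hasFDerivAt_fluxForm (G := F ∘ ψ)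
    (u := fun y => v (ψ y) * starRingEnd ℂ (deriv ψ y)) (fun y hy => ?_) ?_
    (fun y hy => hnn _ (hmaps hy)) hz
  · have hψ' := (hψ.differentiableAt (Metric.isOpen_ball.mem_nhds hy)).hasDerivAt
    refine ((hF.hasFDerivAt _ (hmaps hy)).comp y hψ'.complexToReal_fderiv).congr_fderiv ?_
    ext h
    simp [fluxForm_apply, mul_assoc]
  · refine ((hw.comp hψ hmaps).mul (hψ.deriv Metric.isOpen_ball)).congr fun y _ => ?_
    simp [complexVelocity]

theorem IsStreamFunction.pos_of_nonneg (hK : IsClosed K) (hconn : IsPreconnected Kᶜ)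
    (hF : IsStreamFunction K v F) (hw : DifferentiableOn ℂ (complexVelocity v) Kᶜ)
    (hnn : ∀ z ∈ Kᶜ, 0 ≤ F z) (hpos : ∃ z ∈ Kᶜ, 0 < F z) : ∀ z ∈ Kᶜ, 0 < F z := by
  obtain ⟨z₁, hz₁, hpos⟩ := hpos
  have hlocal (x : ℂ) (hx : x ∈ Kᶜ) : ∀ᶠ y in 𝓝 x, 0 < F y ↔ 0 < F x := by
    obtain ⟨r, hr, hball⟩ := Metric.isOpen_iff.1 hK.isOpen_compl x hx
    filter_upwards [Metric.ball_mem_nhds x hr] with y hy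
    have hharnack := abs_le.1 (hF.abs_comp_sub_le hw hnn differentiableOn_id hball hy)
    simp only [id] at hharnack
    have hlt : dist y x / r < 1 := (div_lt_one hr).2 hy
    have hFx := hnn x hx
    have hFy := hnn y (hball hy)
    constructor <;> intro h <;> nlinarith
  intro z hz
  have hiff := hconn.induction₂ (fun x y => 0 < F x ↔ 0 < F y)
    (fun x hx => ((hlocal x hx).mono fun y hy => hy.symm).filter_mono nhdsWithin_le_nhds)
    (fun x y w _ _ _ hxy hyw => hxy.trans hyw) (fun x y _ _ hxy => hxy.symm) hz₁ hz
  exact hiff.1 hpos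

end PositiveStreamFunction

/-! ### Protruding corners -/

section ProtrudingCorner

open Bornology

variable {K E : Set ℂ} {v : ℂ → ℂ} {F : ℂ → ℝ} {p : ℂ} {Γ κ Θ : ℝ}

theorem HasExteriorAngle.exists_mapsTo_ball_compl (h : HasExteriorAngle K p Θ) (hκ : 0 < κ)
    (hΘ : κ * Real.pi < Θ) :
    ∃ c : ℂ, MapsTo (fun ζ : ℂ => p + c * ζ ^ (κ : ℂ)) (Metric.ball 1 1) Kᶜ := by
  obtain ⟨-, α, hα⟩ := h
  obtain ⟨r, hr, hsector⟩ := hα ((Θ - κ * Real.pi) / 2) (by linarith)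
  refine ⟨(r / 2 ^ κ : ℝ) * Complex.exp ((α + Θ / 2 : ℝ) * Complex.I), fun ζ hζ => ?_⟩
  have hre : 0 < ζ.re := by
    have := (abs_lt.1 ((Complex.abs_re_le_norm _).trans_lt (mem_ball_iff_norm.1 hζ))).1
    rw [Complex.sub_re, Complex.one_re] at this
    linarith
  have hζ₀ : ζ ≠ 0 := fun h => by simp [h] at hre
  have hnorm : ‖ζ‖ < 2 := by
    have := norm_lt_of_mem_ball hζ
    rw [norm_one] at this
    linarith
  have harg := abs_lt.1 (Complex.abs_arg_lt_pi_div_two_iff.2 (Or.inl hre))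
  have hradius : r / 2 ^ κ * ‖ζ‖ ^ κ < r := by
    rw [div_mul_eq_mul_div, div_lt_iff₀ (by positivity)]
    gcongr
  have hmem := (hsector (r / 2 ^ κ * ‖ζ‖ ^ κ) (Θ / 2 + κ * ζ.arg) (by positivity) hradius).1
    (by nlinarith) (by nlinarith)
  convert hmem using 2
  have hpow : ζ ^ (κ : ℂ) = (‖ζ‖ ^ κ : ℝ) * Complex.exp ((κ * ζ.arg : ℝ) * Complex.I) := by
    rw [Complex.cpow_ofReal, Complex.exp_mul_I, mul_comm κ]
    push_cast
    rfl
  rw [hpow, mul_mul_mul_comm, ← Complex.exp_add]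
  push_cast
  ring_nf

theorem not_isBigO_self_rpow (hκ : 1 < κ) : ¬ (id : ℝ → ℝ) =O[𝓝[>] 0] fun x => x ^ κ := by
  intro hO
  have hlim : Tendsto (fun x : ℝ => x ^ (κ - 1)) (𝓝[>] 0) (𝓝 0) :=
    (tendsto_id.mono_left nhdsWithin_le_nhds).rpow_const_nhds_zero (sub_pos.2 hκ)
  have ho : (fun x : ℝ => x ^ κ) =o[𝓝[>] 0] (id : ℝ → ℝ) := by
    rw [Asymptotics.isLittleO_iff_tendsto']
    · refine hlim.congr' ?_
      filter_upwards [self_mem_nhdsWithin] with x hx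
      rw [Real.rpow_sub_one (ne_of_gt hx), id]
    · filter_upwards [self_mem_nhdsWithin] with x hx h
      exact absurd h (ne_of_gt hx)
  refine Asymptotics.isLittleO_irrefl ?_ (hO.trans_isLittleO ho)
  exact ((eventually_mem_nhdsWithin (s := Ioi (0 : ℝ))).mono fun x hx => ne_of_gt hx).frequently

theorem IsStreamFunction.mul_apply_one_le (hF : IsStreamFunction K v F)
    (hw : DifferentiableOn ℂ (complexVelocity v) Kᶜ) (hnn : ∀ z ∈ Kᶜ, 0 ≤ F z) {ψ : ℂ → ℂ}
    (hψ : DifferentiableOn ℂ ψ (Metric.ball 1 1)) (hmaps : MapsTo ψ (Metric.ball 1 1) Kᶜ) {x : ℝ}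
    (hx : x ∈ Ioo (0 : ℝ) 1) : x * F (ψ 1) ≤ 2 * F (ψ x) := by
  have hdist : dist (x : ℂ) 1 = 1 - x := by
    rw [← Complex.ofReal_one, Complex.isometry_ofReal.dist_eq, Real.dist_eq, abs_sub_comm,
      abs_of_pos (sub_pos.2 hx.2)]
  have hmem : (x : ℂ) ∈ Metric.ball (1 : ℂ) 1 := by
    rw [Metric.mem_ball, hdist]
    linarith [hx.1]
  have hharnack := (abs_le.1 (hF.abs_comp_sub_le hw hnn hψ hmaps hmem)).1
  rw [hdist, div_one] at hharnack
  nlinarith [hx.1, hnn _ (hmaps hmem)]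

/-- The conformal map `ζ ↦ p + c * ζ ^ κ` sends a disc touching `0` into a sector of opening more
than `π`. By Harnack's inequality `F` decays at most like `x` along the image of the radius to `0`,
while a bounded velocity makes it `O(x ^ κ)` there. -/
theorem IsStreamFunction.not_velocityBoundedNear_of_mapsTo (hF : IsStreamFunction K v F)
    (hw : DifferentiableOn ℂ (complexVelocity v) Kᶜ) (hpos : ∀ z ∈ Kᶜ, 0 < F z) (hp : p ∈ K)
    (hκ : 1 < κ) {c : ℂ}
    (hmaps : MapsTo (fun ζ : ℂ => p + c * ζ ^ (κ : ℂ)) (Metric.ball 1 1) Kᶜ) :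
    ¬ VelocityBoundedNear K v p := by
  intro hb
  set ψ : ℂ → ℂ := fun ζ => p + c * ζ ^ (κ : ℂ)
  have hψ : DifferentiableOn ℂ ψ (Metric.ball 1 1) := fun ζ hζ =>
    ((differentiableAt_id.cpow_const
      (Complex.ball_one_subset_slitPlane hζ)).const_mul c).const_add p |>.differentiableWithinAt
  have hψ_eq {x : ℝ} (hx : 0 < x) : ψ x - p = c * (x ^ κ : ℝ) := by
    simp [ψ, Complex.ofReal_cpow hx.le]
  have hψ_isBigO : (fun x : ℝ => ψ x - p) =O[𝓝[>] 0] fun x => x ^ κ := by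
    refine .of_bound ‖c‖ (eventually_mem_nhdsWithin.mono fun x hx => ?_)
    rw [hψ_eq hx, norm_mul, Complex.norm_real]
  have hlim : Tendsto (fun x : ℝ => ψ x) (𝓝[>] 0) (𝓝 p) := by
    rw [← tendsto_sub_nhds_zero_iff]
    exact hψ_isBigO.trans_tendsto <|
      (tendsto_id.mono_left nhdsWithin_le_nhds).rpow_const_nhds_zero (one_pos.trans hκ)
  have hlinear : (id : ℝ → ℝ) =O[𝓝[>] 0] fun x => F (ψ x) := by
    have hF₁ : 0 < F (ψ 1) := hpos _ (hmaps (Metric.mem_ball_self one_pos))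
    refine .of_bound (2 / F (ψ 1)) ?_
    filter_upwards [Ioo_mem_nhdsGT one_pos] with x hx
    have hle := hF.mul_apply_one_le hw (fun z hz => (hpos z hz).le) hψ hmaps hx
    rw [id, Real.norm_of_nonneg hx.1.le, div_mul_eq_mul_div, le_div_iff₀ hF₁]
    exact hle.trans (mul_le_mul_of_nonneg_left (Real.le_norm_self _) two_pos.le)
  exact not_isBigO_self_rpow hκ
    (hlinear.trans (((hF.isBigO p hp hb).comp_tendsto hlim).trans hψ_isBigO))

theorem IsStreamFunction.not_velocityBoundedNear_of_isProtrudingCorner (hK : IsClosed K)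
    (hF : IsStreamFunction K v F) (hw : DifferentiableOn ℂ (complexVelocity v) Kᶜ)
    (hpos : ∀ z ∈ Kᶜ, 0 < F z) (hp : IsProtrudingCorner K p) : ¬ VelocityBoundedNear K v p := by
  obtain ⟨Θ, hΘ, -, hangle⟩ := hp
  obtain ⟨κ, hκ, hκΘ⟩ := exists_between ((one_lt_div Real.pi_pos).2 hΘ)
  obtain ⟨c, hmaps⟩ := hangle.exists_mapsTo_ball_compl (one_pos.trans hκ)
    ((lt_div_iff₀ Real.pi_pos).1 hκΘ)
  exact hF.not_velocityBoundedNear_of_mapsTo hw hpos (hK.frontier_subset hangle.1) hκ hmaps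

theorem IsStreamFunction.pos_of_hasCirculation_neg (hK : IsBody K E) (hv : IsFlow K E v)
    (hF : IsStreamFunction K v F) (hinf : HasVelocityAtInfinity v 0) (hΓ : HasCirculation K v Γ)
    (hneg : Γ < 0) : ∀ z ∈ Kᶜ, 0 < F z := by
  have hclosed := hK.isCompact.isClosed
  have hbdd := hK.isCompact.isBounded
  have hlim := hF.tendsto_cobounded_atTop hK hv hinf hΓ hneg
  have hnn : ∀ z ∈ Kᶜ, 0 ≤ F z := by
    refine (hF.nonneg_or_eqOn_zero_of_tendsto_atTop hK hv hlim).resolve_right fun hv₀ => hneg.ne ?_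
    exact hΓ.eq_of_eqOn hbdd hv₀ (fun R _ => by simp)
  exact hF.pos_of_nonneg hclosed hK.isConnected_compl.isPreconnected
    (hv.differentiableOn_complexVelocity hclosed) hnn
    (eventually_mem_set.2 (isBounded_def.1 hbdd) |>.and (hlim.eventually_gt_atTop 0)).exists

end ProtrudingCorner

section Uniqueness

variable {K E : Set ℂ} {v v₁ v₂ : ℂ → ℂ} {p wInf : ℂ} {Γ Γ₁ Γ₂ : ℝ}

theorem IsFlow.circulation_nonneg_of_isProtrudingCorner (hK : IsBody K E) (hv : IsFlow K E v)
    (hinf : HasVelocityAtInfinity v 0) (hΓ : HasCirculation K v Γ) (hp : IsProtrudingCorner K p)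
    (hb : VelocityBoundedNear K v p) : 0 ≤ Γ := by
  by_contra! hneg
  have hclosed := hK.isCompact.isClosed
  obtain ⟨F, hF⟩ := hv.exists_isStreamFunction hK
  exact hF.not_velocityBoundedNear_of_isProtrudingCorner hclosed
    (hv.differentiableOn_complexVelocity hclosed)
    (hF.pos_of_hasCirculation_neg hK hv hinf hΓ hneg) hp hb

theorem IsFlow.circulation_le_of_isProtrudingCorner (hK : IsBody K E) (hv₁ : IsFlow K E v₁)
    (hv₂ : IsFlow K E v₂) (hw₁ : HasVelocityAtInfinity v₁ wInf)
    (hw₂ : HasVelocityAtInfinity v₂ wInf) (hΓ₁ : HasCirculation K v₁ Γ₁)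
    (hΓ₂ : HasCirculation K v₂ Γ₂) (hp : IsProtrudingCorner K p)
    (hb₁ : VelocityBoundedNear K v₁ p) (hb₂ : VelocityBoundedNear K v₂ p) : Γ₁ ≤ Γ₂ :=
  sub_nonneg.1 <| (hv₂.sub hK.isCompact.isClosed hv₁).circulation_nonneg_of_isProtrudingCorner hK
    (hw₂.sub hw₁) (hΓ₂.sub hv₂.differentiableOn.continuousOn hv₁.differentiableOn.continuousOn hΓ₁)
    hp (hb₂.sub hb₁)

theorem IsFlow.eqOn_of_hasCirculation (hK : IsBody K E) (hv₁ : IsFlow K E v₁)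
    (hv₂ : IsFlow K E v₂) (hw₁ : HasVelocityAtInfinity v₁ wInf)
    (hw₂ : HasVelocityAtInfinity v₂ wInf) (hΓ₁ : HasCirculation K v₁ Γ)
    (hΓ₂ : HasCirculation K v₂ Γ) : EqOn v₁ v₂ Kᶜ := by
  have hΓ := hΓ₁.sub hv₁.differentiableOn.continuousOn hv₂.differentiableOn.continuousOn hΓ₂
  rw [sub_self] at hΓ
  exact fun z hz => sub_eq_zero.1 <|
    (hv₁.sub hK.isCompact.isClosed hv₂).eqOn_zero_of_hasCirculation_zero hK (hw₁.sub hw₂) hΓ hz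

end Uniqueness

theorem mainTheorem5 (K E : Set ℂ) (hK : IsBody K E) :
    (∀ v : ℂ → ℂ, IsFlow K E v →
      (∃ wInf : ℂ, HasVelocityAtInfinity v wInf) ∧ (∃ Γ : ℝ, HasCirculation K v Γ)) ∧
    (∀ v₁ v₂ : ℂ → ℂ, IsFlow K E v₁ → IsFlow K E v₂ →
      ∀ (wInf : ℂ) (Γ : ℝ),
        HasVelocityAtInfinity v₁ wInf → HasVelocityAtInfinity v₂ wInf →
        HasCirculation K v₁ Γ → HasCirculation K v₂ Γ →
        Set.EqOn v₁ v₂ Kᶜ) ∧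
    (∀ p : ℂ, IsProtrudingCorner K p →
      ∀ v₁ v₂ : ℂ → ℂ, IsFlow K E v₁ → IsFlow K E v₂ →
        VelocityBoundedNear K v₁ p → VelocityBoundedNear K v₂ p →
        ∀ (wInf : ℂ), HasVelocityAtInfinity v₁ wInf → HasVelocityAtInfinity v₂ wInf →
          Set.EqOn v₁ v₂ Kᶜ ∧
          ∀ Γ₁ Γ₂ : ℝ, HasCirculation K v₁ Γ₁ → HasCirculation K v₂ Γ₂ → Γ₁ = Γ₂) := by
  have hne : K.Nonempty := hK.isConnected_interior.nonempty.mono interior_subset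
  have hcirc {v : ℂ → ℂ} (hv : IsFlow K E v) : ∃ Γ : ℝ, HasCirculation K v Γ :=
    hv.exists_hasCirculation hK.isCompact hne
  refine ⟨fun v hv => ⟨hv.exists_hasVelocityAtInfinity hK.isCompact, hcirc hv⟩,
    fun v₁ v₂ hv₁ hv₂ wInf Γ hw₁ hw₂ => hv₁.eqOn_of_hasCirculation hK hv₂ hw₁ hw₂,
    fun p hp v₁ v₂ hv₁ hv₂ hb₁ hb₂ wInf hw₁ hw₂ => ?_⟩
  have heq {Γ₁ Γ₂ : ℝ} (hΓ₁ : HasCirculation K v₁ Γ₁) (hΓ₂ : HasCirculation K v₂ Γ₂) : Γ₁ = Γ₂ :=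
    le_antisymm (hv₁.circulation_le_of_isProtrudingCorner hK hv₂ hw₁ hw₂ hΓ₁ hΓ₂ hp hb₁ hb₂)
      (hv₂.circulation_le_of_isProtrudingCorner hK hv₁ hw₂ hw₁ hΓ₂ hΓ₁ hp hb₂ hb₁)
  obtain ⟨Γ₁, hΓ₁⟩ := hcirc hv₁
  obtain ⟨Γ₂, hΓ₂⟩ := hcirc hv₂
  exact ⟨hv₁.eqOn_of_hasCirculation hK hv₂ hw₁ hw₂ hΓ₁ (heq hΓ₁ hΓ₂ ▸ hΓ₂), fun _ _ => heq⟩
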